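/- **Setting.** Space is discretized into cells and time into intervals of length $2\Delta T$, $\Delta T>0$. A ride is a sequence of at least two points with nondecreasing times at which they are reached; it gives a sequence of space-time nodes (cell, time interval), and its set representation $E(r)$ is the set of ordered pairs of consecutive nodes (edges). Edges have costs $w(e)\ge 0$, and the similarity of two rides is $S(q,r)=\sum_{e\in E(q)\cap E(r)}w(e)$. All rides, including the query rides, have $E(r)\subseteq E$ for a finite edge set $E$ with $|E|\le D$ and $w\le W$ on $E$. A randomized data structure over rides $r_1,\dots,r_n$ solves *$(c,s,k)$-approximate Overlapping Match Search with failure probability $f$* if, for every fixed query ride $q$ for which at least $k$ of the rides $r_i$ satisfy $S(q,r_i)\ge s$, it reports, with probability at least $1-f$, exactly $k$ of the rides, all with $S(q,r_i)\ge cs$. **Algorithm** (parameters $\lambda$, $t$, $L$, $B$). For a ride $r$ let $p_r\in\mathbb R^{E}$ have the entry $w(e)$ at $e\in E(r)$ and $0$ elsewhere; multiply all $p_r$ by a common factor $\lambda>0$ such that $\|\lambda p_r\|_2\le 0.75$. Let $q_r\in\mathbb R^{E}$ be the indicator vector of $E(r)$, normalized to norm $1$. Put $P(x)=[x;\tfrac12-\|x\|^2;\tfrac12-\|x\|^4]$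 and $Q(x)=[x;0;0]$. A cross-polytope hash function is $h_A(x)=$ the vertex among $\pm e_i$ nearest to $Ax/\|Ax\|$, where $A$ is a square matrix with independent standard Gaussian entries. Each of $L$ hash tables stores all $P(\lambda p_{r_i})$ under the concatenation of $t$ such functions, all independent. A query $q$ goes through the tables in turn and through the bucket of $Q(q_q)$ in each of them, computes the similarities of the rides it meets, and keeps the distinct rides with $S(q,r_i)\ge cs$; it stops when $k$ of them have been found, or when $B$ rides with $S(q,r_i)<cs$ (counted with multiplicity) have been met. The whole algorithm builds the tables and then queries with each of the $n$ rides. Time is counted in unit-cost steps (arithmetic operations and comparisons of reals, list and dictionary accesses, with the vector representations of the rides being read coordinate by coordinate), space in machine words, each of which holds a real number, a ride index or the key of a bucket. **Theorem.** Let $0<c<1$, $s>0$, $D\in\mathbb N$ and $W\in\mathbb R$. There are $0<\rho<1$, $0<p<1$ and $\lambda>0$, depending only on $c,s,D,W$, such that for every $0<f<1$ there are $b\in\mathbb N$ and $K>0$, depending only on these and on $f$, with the following property. For every discretization, edge set and costs as above and all $n,k\ge1$ and rides $r_1,\dots,r_n$, the algorithm with the scale $\lambda$ and $$t=\Big\lfloor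 \frac{\log n}{\log(1/p)}\Big\rfloor,\qquad L=\lceil n^\rho\ln(k/f)\rceil,\qquad B=bL$$ satisfies $\|\lambda p_{r_i}\|\le 0.75$ for all $i$, and 1. it solves $(c,s,k)$-approximate Overlapping Match Search with failure probability $f$; 2. every query takes at most $K\,n^\rho(k+\log n)\log(k+1)$ steps; 3. the data structure takes at most $K\,n^{1+\rho}\log(k+1)$ words; 4. the total running time is at most $K\,n^{1+\rho}(k+\log n)\log(k+1)$ steps. The bounds 2–4 hold for every outcome of the random choices. -/

import Mathlib

open MeasureTheory ProbabilityTheory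

noncomputable section

namespace Carpool

universe u v w

/-! ### Rides, discretization and overlap similarity -/

/-- A ride: the route it follows when served without delay, from pickup (first stop) to dropoff
(last stop), as a sequence of points together with the times at which they are reached. -/
structure Ride (Pt : Type u) where
  stops : List (Pt × ℝ)
  two_le_length : 2 ≤ stops.length
  times_monotone : stops.Pairwise (fun a b => a.2 ≤ b.2)

/-- A space discretization (each point lies in a cell) together with the maximum allowable
delay `delay`; time is cut into intervals of length `2 * delay`. -/
structure Discretization (Pt : Type u) (Cell : Type v) where
  cell : Pt → Cell
  delay : ℝ
  delay_pos : 0 < delay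

/-- A space-time discretized node: a cell and the number of a time interval. -/
abbrev STNode (Cell : Type v) := Cell × ℤ

/-- A space-time discretized edge: an ordered pair of nodes. -/
abbrev STEdge (Cell : Type v) := STNode Cell × STNode Cell

variable {Pt : Type u} {Cell : Type v}

/-- The node of a point reached at a given time. -/
def Discretization.node (disc : Discretization Pt Cell) (a : Pt × ℝ) : STNode Cell :=
  (disc.cell a.1, ⌊a.2 / (2 * disc.delay)⌋)

/-- The sequence of space-time discretized nodes of a ride. -/
def Discretization.nodes (disc : Discretization Pt Cell) (r : Ride Pt) : List (STNode Cell) :=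
  r.stops.map disc.node

open Classical in
/-- The spatio-temporal set representation: the set of pairs of consecutive nodes. -/
def Discretization.edges (disc : Discretization Pt Cell) (r : Ride Pt) : Finset (STEdge Cell) :=
  ((disc.nodes r).zip (disc.nodes r).tail).toFinset

open Classical in
/-- Overlap similarity: total cost of the common space-time discretized edges. -/
def similarity (disc : Discretization Pt Cell) (cost : STEdge Cell → ℝ) (q r : Ride Pt) : ℝ :=
  ∑ e ∈ disc.edges q ∩ disc.edges r, cost e

/-- A randomized search procedure over the rides `R`, with randomness `ω` distributed as `μ` and
fixed before the query, solves `(c, s, k)`-approximate Overlapping Match Search with failure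
probability `f`, for the query rides in `queries`: if there are `k` rides of `R` of similarity at
least `s` with the query, then, except with probability at most `f`, it reports exactly `k` rides
of `R`, all of similarity at least `c * s` with the query. -/
def SolvesOMS {Ω : Type w} [MeasurableSpace Ω] (μ : Measure Ω)
    (disc : Discretization Pt Cell) (cost : STEdge Cell → ℝ) {n : ℕ} (R : Fin n → Ride Pt)
    (queries : Set (Ride Pt)) (report : Ω → Ride Pt → Finset (Fin n))
    (c s : ℝ) (k : ℕ) (f : ℝ) : Prop :=
  ∀ q ∈ queries,
    (∃ T : Finset (Fin n), T.card = k ∧ ∀ i ∈ T, s ≤ similarity disc cost q (R i)) →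
    μ {ω | ¬ ((report ω q).card = k ∧
        ∀ i ∈ report ω q, c * s ≤ similarity disc cost q (R i))} ≤ ENNReal.ofReal f

/-! ### Vector representations; the coordinates are the edges in a finite set `E` -/

open Classical in
/-- Spatio-temporal preprocessing vector representation. -/
def prepVec (disc : Discretization Pt Cell) (cost : STEdge Cell → ℝ)
    (E : Finset (STEdge Cell)) (r : Ride Pt) : EuclideanSpace ℝ E :=
  WithLp.toLp 2 fun e => if (e : STEdge Cell) ∈ disc.edges r then cost e else 0

open Classical in
/-- Spatio-temporal query vector representation. -/
def queryVec (disc : Discretization Pt Cell) (E : Finset (STEdge Cell)) (r : Ride Pt) :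
    EuclideanSpace ℝ E :=
  WithLp.toLp 2 fun e => if (e : STEdge Cell) ∈ disc.edges r then 1 else 0

/-! ### Asymmetric transformations `P`, `Q` and cross-polytope hashing -/

/-- `P(x) = [x; 1/2 - ‖x‖ ^ 2; 1/2 - ‖x‖ ^ 4; …; 1/2 - ‖x‖ ^ (2 ^ m)]`. -/
def prepTransform {ι : Type w} [Fintype ι] (m : ℕ) (x : EuclideanSpace ℝ ι) :
    EuclideanSpace ℝ (ι ⊕ Fin m) :=
  WithLp.toLp 2 (Sum.elim (fun i => x i) (fun j => 1 / 2 - ‖x‖ ^ (2 ^ ((j : ℕ) + 1))))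

/-- `Q(x) = [x; 0; …; 0]`. -/
def queryTransform {ι : Type w} [Fintype ι] (m : ℕ) (x : EuclideanSpace ℝ ι) :
    EuclideanSpace ℝ (ι ⊕ Fin m) :=
  WithLp.toLp 2 (Sum.elim (fun i => x i) (fun _ => 0))

open Classical in
/-- The vertices `± e_i` of the cross-polytope. -/
def vertex {κ : Type w} [Fintype κ] (a : κ × Bool) : EuclideanSpace ℝ κ :=
  EuclideanSpace.single a.1 (if a.2 then (1 : ℝ) else -1)

lemma exists_nearest_vertex {κ : Type w} [Fintype κ] [Nonempty κ] (y : EuclideanSpace ℝ κ) :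
    ∃ a : κ × Bool, ∀ b : κ × Bool, dist y (vertex a) ≤ dist y (vertex b) :=
  Finite.exists_min fun a : κ × Bool => dist y (vertex a)

/-- The cross-polytope hash of `x` for the matrix `A`: the vertex nearest to `A x / ‖A x‖`. -/
def crossPolytopeHash {κ : Type w} [Fintype κ] [Nonempty κ] (A : κ → κ → ℝ)
    (x : EuclideanSpace ℝ κ) : κ × Bool :=
  let y : EuclideanSpace ℝ κ := WithLp.toLp 2 (Matrix.mulVec (Matrix.of A) x.ofLp)
  Classical.choose (exists_nearest_vertex (‖y‖⁻¹ • y))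

/-- The law of a square matrix with independent standard Gaussian entries. -/
def gaussianMatrix (κ : Type w) [Fintype κ] : Measure (κ → κ → ℝ) :=
  Measure.pi fun _ => Measure.pi fun _ => gaussianReal 0 1

/-! ### The algorithm with its step count

Unit-cost model: an arithmetic operation or comparison of real numbers, access to an entry of a
list and access to a dictionary cost one step. A machine word holds a real number, the index of a
ride, or the key of a bucket (a sequence of `t` symbols of a fixed finite alphabet). -/

/-- A value together with the number of steps spent on computing it. -/
structure Counted (α : Type w) where
  val : α
  steps : ℕ

/-- Numerical parameters of the algorithm: approximation factor `c`, threshold `s`, number `k` of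
matches, common factor `scale` by which the preprocessing vectors are multiplied, number `t` of
concatenated hash functions per table, number `L` of tables, and the number `budget` of dissimilar
rides after which a query gives up. -/
structure Params where
  c : ℝ
  s : ℝ
  k : ℕ
  scale : ℝ
  t : ℕ
  L : ℕ
  budget : ℕ

/-- Coordinates after the transformations, which are used with `m = 2`. -/
abbrev Coord (E : Finset (STEdge Cell)) := E ⊕ Fin 2

/-- Keys of buckets: `t` concatenated hash values. -/
abbrev Key (E : Finset (STEdge Cell)) (t : ℕ) := Fin t → Coord E × Bool

/-- The random choices: `t` matrices for each of the `L` tables. -/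
abbrev Seed (E : Finset (STEdge Cell)) (prm : Params) :=
  Fin prm.L → Fin prm.t → Coord E → Coord E → ℝ

/-- All the matrices are independent and Gaussian. -/
def seedLaw (E : Finset (STEdge Cell)) (prm : Params) : Measure (Seed E prm) :=
  Measure.pi fun _ => Measure.pi fun _ => gaussianMatrix (Coord E)

/-- The concatenated hash value of a vector: in dimension `d`, each hash function costs `2 d ^ 2`
for the product `A x` and `2 d` for finding the nearest vertex (the largest signed coordinate);
forming the key costs `t` more. -/
def hashKey (E : Finset (STEdge Cell)) {t : ℕ} (A : Fin t → Coord E → Coord E → ℝ)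
    (x : EuclideanSpace ℝ (Coord E)) : Counted (Key E t) where
  val := fun j => crossPolytopeHash (A j) x
  steps := t * (2 * (E.card + 2) ^ 2 + 2 * (E.card + 2)) + t

/-- The scaled preprocessing vector of a ride. -/
def scaledPrep (disc : Discretization Pt Cell) (cost : STEdge Cell → ℝ)
    (E : Finset (STEdge Cell)) (prm : Params) (r : Ride Pt) : EuclideanSpace ℝ E :=
  prm.scale • prepVec disc cost E r

/-- The vector `P(p_r)` of a ride, computed coordinate by coordinate. -/
def prepPoint (disc : Discretization Pt Cell) (cost : STEdge Cell → ℝ)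
    (E : Finset (STEdge Cell)) (prm : Params) (r : Ride Pt) :
    Counted (EuclideanSpace ℝ (Coord E)) where
  val := prepTransform 2 (scaledPrep disc cost E prm r)
  steps := 4 * E.card + 4

/-- The vector `Q(q_r)` of a ride, where `q_r` is normalized to norm one. -/
def queryPoint (disc : Discretization Pt Cell) (E : Finset (STEdge Cell)) (r : Ride Pt) :
    Counted (EuclideanSpace ℝ (Coord E)) where
  val := queryTransform 2 (‖queryVec disc E r‖⁻¹ • queryVec disc E r)
  steps := 4 * E.card + 4

/-- A hash table is a dictionary that sends a key to its bucket of rides. -/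
abbrev Table (E : Finset (STEdge Cell)) (t n : ℕ) := Key E t → List (Fin n)

open Classical in
/-- One hash table, built by inserting the `n` transformed vectors one after the other. -/
def buildTable (E : Finset (STEdge Cell)) {t n : ℕ} (A : Fin t → Coord E → Coord E → ℝ)
    (x : Fin n → EuclideanSpace ℝ (Coord E)) : Counted (Table E t n) :=
  (List.finRange n).foldl
    (fun T i =>
      let g := hashKey E A (x i)
      { val := Function.update T.val g.val (i :: T.val g.val)
        steps := T.steps + g.steps + 1 })
    { val := fun _ => [], steps := 0 }

/-- The LSH dataset: transform all rides and build the `L` tables. -/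
def buildIndex (disc : Discretization Pt Cell) (cost : STEdge Cell → ℝ)
    (E : Finset (STEdge Cell)) (prm : Params) {n : ℕ} (R : Fin n → Ride Pt) (ω : Seed E prm) :
    Counted (Fin prm.L → Table E prm.t n) where
  val := fun j => (buildTable E (ω j) fun i => (prepPoint disc cost E prm (R i)).val).val
  steps := (∑ i, (prepPoint disc cost E prm (R i)).steps) +
    ∑ j, (buildTable E (ω j) fun i => (prepPoint disc cost E prm (R i)).val).steps

/-- Words stored by a hash table: for every nonempty bucket its key and its entries. -/
def tableWords (E : Finset (STEdge Cell)) {t n : ℕ} (T : Table E t n) : ℕ :=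
  ∑ κ : Key E t, if (T κ).isEmpty then 0 else 1 + (T κ).length

/-- Words stored in total: the tables, the matrices of all hash functions, and the representations
of the rides. -/
def indexWords (disc : Discretization Pt Cell) (cost : STEdge Cell → ℝ)
    (E : Finset (STEdge Cell)) (prm : Params) {n : ℕ} (R : Fin n → Ride Pt)
    (ω : Seed E prm) : ℕ :=
  (∑ j, tableWords E ((buildIndex disc cost E prm R ω).val j)) +
    prm.L * prm.t * (E.card + 2) ^ 2 + n * (E.card + 2)

/-- State of a query: the set of distinct matches found, the number of dissimilar rides met (with
multiplicity), and the number of steps spent. -/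
structure QueryState (n : ℕ) where
  found : Finset (Fin n)
  dissimilar : ℕ
  steps : ℕ

/-- A query stops when `k` matches are found or the budget of dissimilar rides is spent. -/
def QueryState.Halted (prm : Params) {n : ℕ} (st : QueryState n) : Prop :=
  prm.k ≤ st.found.card ∨ prm.budget ≤ st.dissimilar

open Classical in
/-- Process one ride taken from a bucket: compute its similarity with the query (`2 |E|` steps),
compare, and record it (three more steps). A halted query does nothing. -/
def examine (disc : Discretization Pt Cell) (cost : STEdge Cell → ℝ)
    (E : Finset (STEdge Cell)) (prm : Params) {n : ℕ} (R : Fin n → Ride Pt) (q : Ride Pt)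
    (st : QueryState n) (i : Fin n) : QueryState n :=
  if st.Halted prm then st
  else if prm.c * prm.s ≤ similarity disc cost q (R i) then
    { found := insert i st.found
      dissimilar := st.dissimilar
      steps := st.steps + (2 * E.card + 3) }
  else
    { found := st.found
      dissimilar := st.dissimilar + 1
      steps := st.steps + (2 * E.card + 3) }

open Classical in
/-- Hash the query with the functions of table `j`, look up its bucket and go through it. -/
def probeTable (disc : Discretization Pt Cell) (cost : STEdge Cell → ℝ)
    (E : Finset (STEdge Cell)) (prm : Params) {n : ℕ} (R : Fin n → Ride Pt) (ω : Seed E prm)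
    (tables : Fin prm.L → Table E prm.t n) (q : Ride Pt)
    (st : QueryState n) (j : Fin prm.L) : QueryState n :=
  if st.Halted prm then st
  else
    let g := hashKey E (ω j) (queryPoint disc E q).val
    (tables j g.val).foldl (examine disc cost E prm R q)
      { found := st.found
        dissimilar := st.dissimilar
        steps := st.steps + g.steps + 1 }

/-- The query: go through the `L` tables in turn. -/
def runQuery (disc : Discretization Pt Cell) (cost : STEdge Cell → ℝ)
    (E : Finset (STEdge Cell)) (prm : Params) {n : ℕ} (R : Fin n → Ride Pt) (ω : Seed E prm)
    (q : Ride Pt) : QueryState n :=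
  (List.finRange prm.L).foldl
    (probeTable disc cost E prm R ω (buildIndex disc cost E prm R ω).val q)
    { found := ∅, dissimilar := 0, steps := (queryPoint disc E q).steps }

/-- Steps of the whole algorithm: build the LSH dataset, then query it with every ride. -/
def totalSteps (disc : Discretization Pt Cell) (cost : STEdge Cell → ℝ)
    (E : Finset (STEdge Cell)) (prm : Params) {n : ℕ} (R : Fin n → Ride Pt)
    (ω : Seed E prm) : ℕ :=
  (buildIndex disc cost E prm R ω).steps + ∑ i, (runQuery disc cost E prm R ω (R i)).steps

/-- Parameters for a pool of `n` rides: `t = ⌊log n / log (1 / p)⌋` hash functions per table,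
`L = ⌈n ^ ρ * ln (k / f)⌉` tables, and a budget of `b * L` dissimilar rides. -/
def params (c s scale p ρ f : ℝ) (b k n : ℕ) : Params where
  c := c
  s := s
  k := k
  scale := scale
  t := ⌊Real.log n / Real.log (1 / p)⌋₊
  L := ⌈(n : ℝ) ^ ρ * Real.log (k / f)⌉₊
  budget := b * ⌈(n : ℝ) ^ ρ * Real.log (k / f)⌉₊

end Carpool

end

/-!
Two facts make the algorithm work.

*Cross-polytope hashing separates angles.* For a Gaussian matrix `A` and unit vectors `x`, `y` with
inner product `α`, the collision probability is `∑ v, E[f_v(A x) f_v(A y)]`, where `f_v` is the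
indicator of the cell of the vertex `v`. The law of `(A x, A y)` depends only on the Gram matrix of
`x` and `y` (`map_dotProduct_pair_congr`), so that for every square-integrable `f` the expectation
`E[f(A x) f(A y)]` is a function `gaussianCorr f α`, and it is a positive semidefinite kernel on the
unit spheres of all dimensions. Testing it on `2 N` vectors in two groups and letting `N` tend to
infinity shows that it is nondecreasing on `[0, 1]` (`gaussianCorr_mono`). Applied to `f` minus its
projection to a coordinate, the same statement bounds the growth of `gaussianCorr f` below by the
square of a first-order Hermite coefficient (`gaussianCorr_gap`), and for the cells these squares
have a sum that is bounded below in terms of the dimension (`sq_gaussianAbsMoment_le`). Hence the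
collision probability is strictly increasing in `α`, with an explicit slope (`hashCorr_gap`). If
the scale is small then the transformations turn a gap between similarities with one query into a
gap between angles, so that, uniformly in all data, similar rides are hit with probability at
least `P` and dissimilar rides are hit at most `ratio` times as often, with `ratio < 1`
(`le_hitProb_of_similar`, `hitProb_gap`). The two probabilities can be compared only for the same
query and the same edge set; no threshold separates them for all queries at once.

*Similar rides win the race.* With `p = (P / 2) ^ 2` and `ρ = 1 / 2` the key length `t` is so small
that all `k` similar rides are met except with probability `f ^ 2` (`mul_one_sub_pow_le`). A
dissimilar ride is met before a given similar one, or in the same table, with probability at most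
`ratio ^ t` (`real_race_le`). The position of a ride in the tables depends only on its set of edges,
so there are at most `4 ^ |E|` different races, and for large `t` the similar rides win all of them,
except with probability `f - f ^ 2`; the budget is then never touched before `k` rides have been
found (`real_failureEvent_le`). The remaining `t` are bounded in terms of `f`, and so is `n`; a
budget of more than `n` dissimilar rides per table cannot be exhausted
(`real_failureEvent_le_of_lt_budget`).

The bounds on time and space are deterministic. A bucket has no repetitions, so that a query
examines at most `k` similar rides in each table, and at most `B` dissimilar rides altogether
(`runQuery_steps_le`).
-/

noncomputable section

namespace Carpool

universe u v w

/-! ### Gaussian matrices applied to vectors -/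

/-- The law of a vector with independent standard Gaussian entries. -/
def gaussianVector (ι : Type*) [Fintype ι] : Measure (ι → ℝ) :=
  Measure.pi fun _ => gaussianReal 0 1

/-- The law of a rectangular matrix with independent standard Gaussian entries. -/
def gaussianRect (κ ι : Type*) [Fintype κ] [Fintype ι] : Measure (κ → ι → ℝ) :=
  Measure.pi fun _ => gaussianVector ι

instance (ι : Type*) [Fintype ι] : IsProbabilityMeasure (gaussianVector ι) := by
  unfold gaussianVector; infer_instance

instance (κ ι : Type*) [Fintype κ] [Fintype ι] : IsProbabilityMeasure (gaussianRect κ ι) := by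
  unfold gaussianRect; infer_instance

/-- The characteristic function of a linear form in independent standard Gaussians. -/
lemma integral_cexp_dotProduct_gaussianVector {ι : Type*} [Fintype ι] (c : ι → ℝ) :
    ∫ a, Complex.exp (((a ⬝ᵥ c : ℝ) : ℂ) * Complex.I) ∂gaussianVector ι =
      Complex.exp (-((c ⬝ᵥ c : ℝ) : ℂ) / 2) := by
  have h1 : ∀ a : ι → ℝ, Complex.exp (((a ⬝ᵥ c : ℝ) : ℂ) * Complex.I) =
      ∏ i, Complex.exp ((c i : ℂ) * (a i : ℂ) * Complex.I) := by
    intro a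
    rw [← Complex.exp_sum]
    congr 1
    simp only [dotProduct, Complex.ofReal_sum, Complex.ofReal_mul, Finset.sum_mul]
    exact Finset.sum_congr rfl fun i _ => by ring
  simp_rw [h1]
  rw [gaussianVector, integral_fintype_prod_eq_prod
    (f := fun i (z : ℝ) => Complex.exp ((c i : ℂ) * (z : ℂ) * Complex.I))]
  have h2 : ∀ i, ∫ z : ℝ, Complex.exp ((c i : ℂ) * (z : ℂ) * Complex.I) ∂gaussianReal 0 1 =
      Complex.exp (-((c i * c i : ℝ) : ℂ) / 2) := by
    intro i
    rw [← charFun_apply_real, charFun_gaussianReal]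
    congr 1
    push_cast
    simp
    ring
  simp_rw [h2, ← Complex.exp_sum, dotProduct]
  congr 1
  push_cast
  rw [← Finset.sum_div, Finset.sum_neg_distrib]

lemma measurable_dotProduct_const {ι : Type*} [Fintype ι] (x : ι → ℝ) :
    Measurable fun a : ι → ℝ => a ⬝ᵥ x := by
  unfold dotProduct; fun_prop

lemma linear_combination_dotProduct {ι : Type*} [Fintype ι] (r s : ℝ) (z w a : ι → ℝ) :
    r * (a ⬝ᵥ z) + s * (a ⬝ᵥ w) = a ⬝ᵥ (r • z + s • w) := by
  rw [dotProduct_add, dotProduct_smul, dotProduct_smul]; rfl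

/-- The joint law of two linear forms in independent standard Gaussians depends only on the Gram
matrix of their coefficient vectors. -/
lemma map_dotProduct_pair_congr {ι ι' : Type*} [Fintype ι] [Fintype ι'] {x y : ι → ℝ}
    {x' y' : ι' → ℝ} (hxx : x ⬝ᵥ x = x' ⬝ᵥ x') (hxy : x ⬝ᵥ y = x' ⬝ᵥ y')
    (hyy : y ⬝ᵥ y = y' ⬝ᵥ y') :
    (gaussianVector ι).map (fun a => (a ⬝ᵥ x, a ⬝ᵥ y)) =
      (gaussianVector ι').map (fun a => (a ⬝ᵥ x', a ⬝ᵥ y')) := by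
  have hm := (measurable_dotProduct_const x).prodMk (measurable_dotProduct_const y)
  have hm' := (measurable_dotProduct_const x').prodMk (measurable_dotProduct_const y')
  have : IsProbabilityMeasure ((gaussianVector ι).map (fun a => (a ⬝ᵥ x, a ⬝ᵥ y))) :=
    Measure.isProbabilityMeasure_map hm.aemeasurable
  have : IsProbabilityMeasure ((gaussianVector ι').map (fun a => (a ⬝ᵥ x', a ⬝ᵥ y'))) :=
    Measure.isProbabilityMeasure_map hm'.aemeasurable
  apply Measure.ext_of_charFunDual
  ext T
  have hT : ∀ a b : ℝ, T (a, b) = T (1, 0) * a + T (0, 1) * b := by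
    intro a b
    have : ((a, b) : ℝ × ℝ) = a • (1, 0) + b • (0, 1) := by simp
    rw [this, map_add, map_smul, map_smul]
    simp [mul_comm]
  rw [charFunDual_apply, charFunDual_apply,
    integral_map hm.aemeasurable (by fun_prop), integral_map hm'.aemeasurable (by fun_prop)]
  have hx (a : ι → ℝ) : T (a ⬝ᵥ x, a ⬝ᵥ y) = a ⬝ᵥ (T (1, 0) • x + T (0, 1) • y) := by
    rw [hT, linear_combination_dotProduct]
  have hx' (a : ι' → ℝ) : T (a ⬝ᵥ x', a ⬝ᵥ y') = a ⬝ᵥ (T (1, 0) • x' + T (0, 1) • y') := by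
    rw [hT, linear_combination_dotProduct]
  simp only [hx, hx']
  rw [integral_cexp_dotProduct_gaussianVector, integral_cexp_dotProduct_gaussianVector]
  congr 3
  simp only [add_dotProduct, dotProduct_add, smul_dotProduct, dotProduct_smul, smul_eq_mul]
  rw [dotProduct_comm y x, dotProduct_comm y' x', hxx, hxy, hyy]

lemma measurable_mulVec_const {κ ι : Type*} [Fintype κ] [Fintype ι] (x : ι → ℝ) :
    Measurable fun A : κ → ι → ℝ => Matrix.mulVec (Matrix.of A) x := by
  unfold Matrix.mulVec dotProduct; simp only [Matrix.of_apply]; fun_prop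

/-- Expectations of functions of `(A x, A y)`, for a Gaussian matrix `A`, depend only on the Gram
matrix of `x` and `y`. -/
lemma integral_mulVec_pair_congr {κ ι ι' : Type*} [Fintype κ] [Fintype ι] [Fintype ι']
    {x y : ι → ℝ} {x' y' : ι' → ℝ} (hxx : x ⬝ᵥ x = x' ⬝ᵥ x') (hxy : x ⬝ᵥ y = x' ⬝ᵥ y')
    (hyy : y ⬝ᵥ y = y' ⬝ᵥ y') {F : (κ → ℝ) → (κ → ℝ) → ℝ}
    (hF : Measurable fun z : (κ → ℝ) × (κ → ℝ) => F z.1 z.2) :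
    ∫ A, F (Matrix.mulVec (Matrix.of A) x) (Matrix.mulVec (Matrix.of A) y) ∂gaussianRect κ ι =
      ∫ A, F (Matrix.mulVec (Matrix.of A) x') (Matrix.mulVec (Matrix.of A) y')
        ∂gaussianRect κ ι' := by
  have hrow := (measurable_dotProduct_const x).prodMk (measurable_dotProduct_const y)
  have hrow' := (measurable_dotProduct_const x').prodMk (measurable_dotProduct_const y')
  have e1 : (gaussianRect κ ι).map (fun A i => (A i ⬝ᵥ x, A i ⬝ᵥ y)) =
      Measure.pi fun _ => (gaussianVector ι).map (fun a => (a ⬝ᵥ x, a ⬝ᵥ y)) :=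
    Measure.pi_map_pi (fun _ => hrow.aemeasurable)
  have e2 : (gaussianRect κ ι').map (fun A i => (A i ⬝ᵥ x', A i ⬝ᵥ y')) =
      Measure.pi fun _ => (gaussianVector ι').map (fun a => (a ⬝ᵥ x', a ⬝ᵥ y')) :=
    Measure.pi_map_pi (fun _ => (hrow').aemeasurable)
  have hG : Measurable fun z : κ → ℝ × ℝ => F (fun i => (z i).1) (fun i => (z i).2) :=
    hF.comp ((measurable_pi_lambda _ fun i => (measurable_pi_apply i).fst).prodMk
      (measurable_pi_lambda _ fun i => (measurable_pi_apply i).snd))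
  have m1 : Measurable fun (A : κ → ι → ℝ) i => (A i ⬝ᵥ x, A i ⬝ᵥ y) :=
    measurable_pi_lambda _ fun i => hrow.comp (measurable_pi_apply i)
  have m2 : Measurable fun (A : κ → ι' → ℝ) i => (A i ⬝ᵥ x', A i ⬝ᵥ y') :=
    measurable_pi_lambda _ fun i => (hrow').comp (measurable_pi_apply i)
  have h1 := integral_map (μ := gaussianRect κ ι) m1.aemeasurable hG.aestronglyMeasurable
  have h2 := integral_map (μ := gaussianRect κ ι') m2.aemeasurable hG.aestronglyMeasurable
  rw [e1, map_dotProduct_pair_congr hxx hxy hyy, ← e2] at h1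
  exact h1.symm.trans h2

/-! ### Correlation functionals of Gaussian vectors -/

lemma measurePreserving_mulVec {κ ι : Type*} [Fintype κ] [Fintype ι] {x : ι → ℝ}
    (hx : x ⬝ᵥ x = 1) :
    MeasurePreserving (fun A : κ → ι → ℝ => Matrix.mulVec (Matrix.of A) x)
      (gaussianRect κ ι) (gaussianVector κ) := by
  refine ⟨measurable_mulVec_const x, ?_⟩
  have hrow : (gaussianVector ι).map (fun a => a ⬝ᵥ x) = gaussianReal 0 1 := by
    have : IsProbabilityMeasure ((gaussianVector ι).map (fun a => a ⬝ᵥ x)) :=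
      Measure.isProbabilityMeasure_map (measurable_dotProduct_const x).aemeasurable
    apply Measure.ext_of_charFun
    ext r
    rw [charFun_apply_real, integral_map (measurable_dotProduct_const x).aemeasurable
      (by fun_prop), charFun_gaussianReal]
    have h := integral_cexp_dotProduct_gaussianVector (r • x)
    simp only [dotProduct_smul, smul_dotProduct, hx, smul_eq_mul, Complex.ofReal_mul] at h
    rw [h]
    congr 1
    push_cast
    ring
  have h := Measure.pi_map_pi (μ := fun _ : κ => gaussianVector ι)
    (f := fun _ a => a ⬝ᵥ x) (fun _ => (measurable_dotProduct_const x).aemeasurable)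
  simp only [hrow] at h
  exact h

/-- `E[f(X) f(Y)]` for standard Gaussian vectors `X`, `Y` whose coordinates have correlation `α`
(for `|α| ≤ 1`). -/
def gaussianCorr {κ : Type*} [Fintype κ] (f : (κ → ℝ) → ℝ) (α : ℝ) : ℝ :=
  ∫ A, f (Matrix.mulVec (Matrix.of A) ![1, 0]) * f (Matrix.mulVec (Matrix.of A) ![α, √(1 - α ^ 2)])
    ∂gaussianRect κ (Fin 2)

lemma sq_dotProduct_le_one {ι : Type*} [Fintype ι] {x y : ι → ℝ} (hx : x ⬝ᵥ x = 1)
    (hy : y ⬝ᵥ y = 1) : (x ⬝ᵥ y) ^ 2 ≤ 1 := by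
  have h := Finset.sum_mul_sq_le_sq_mul_sq Finset.univ x y
  simp only [dotProduct] at *
  simp only [sq] at *
  rw [hx, hy] at h
  linarith

lemma cos_sin_dotProduct_self {α : ℝ} (h : α ^ 2 ≤ 1) :
    ![α, √(1 - α ^ 2)] ⬝ᵥ ![α, √(1 - α ^ 2)] = 1 := by
  simp only [dotProduct, Fin.sum_univ_two, Matrix.cons_val_zero, Matrix.cons_val_one]
  rw [Real.mul_self_sqrt (by linarith)]
  ring

lemma integral_mulVec_mul_mulVec {κ ι : Type*} [Fintype κ] [Fintype ι] {f : (κ → ℝ) → ℝ}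
    (hf : Measurable f) {x y : ι → ℝ} (hx : x ⬝ᵥ x = 1) (hy : y ⬝ᵥ y = 1) :
    ∫ A, f (Matrix.mulVec (Matrix.of A) x) * f (Matrix.mulVec (Matrix.of A) y)
      ∂gaussianRect κ ι = gaussianCorr f (x ⬝ᵥ y) := by
  have h := sq_dotProduct_le_one hx hy
  refine integral_mulVec_pair_congr (F := fun a b => f a * f b) ?_ ?_ ?_ ?_
  · simp [hx]
  · simp
  · rw [hy, cos_sin_dotProduct_self h]
  · exact (hf.comp measurable_fst).mul (hf.comp measurable_snd)

lemma memLp_comp_mulVec {κ ι : Type*} [Fintype κ] [Fintype ι] {f : (κ → ℝ) → ℝ}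
    (hf : MemLp f 2 (gaussianVector κ)) {x : ι → ℝ} (hx : x ⬝ᵥ x = 1) :
    MemLp (fun A => f (Matrix.mulVec (Matrix.of A) x)) 2 (gaussianRect κ ι) :=
  hf.comp_measurePreserving (measurePreserving_mulVec hx)

/-- Coordinates for a system of unit vectors in two groups of size `N`: one coordinate shared by
all, one for each group, one for each vector. -/
abbrev ClusterCoord (N : ℕ) := Unit ⊕ (Bool ⊕ (Bool × Fin N))

/-- Unit vectors in two groups, with inner product `b` within a group and `a` across the groups. -/
def clusterVec (a b : ℝ) {N : ℕ} (p : Bool × Fin N) : ClusterCoord N → ℝ :=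
  Sum.elim (fun _ => √a) (Sum.elim (fun g => if g = p.1 then √(b - a) else 0)
    (fun r => if r = p then √(1 - b) else 0))

lemma clusterVec_dotProduct {a b : ℝ} (ha : 0 ≤ a) (hab : a ≤ b) (hb : b ≤ 1) {N : ℕ}
    (p q : Bool × Fin N) :
    clusterVec a b p ⬝ᵥ clusterVec a b q =
      a + (if p.1 = q.1 then b - a else 0) + (if p = q then 1 - b else 0) := by
  simp only [clusterVec, dotProduct, Fintype.sum_sum_type, Sum.elim_inl, Sum.elim_inr,
    Finset.univ_unique, Finset.sum_singleton, ite_mul, zero_mul, Finset.sum_ite_eq',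
    Finset.mem_univ, if_true, mul_ite, mul_zero]
  rw [Real.mul_self_sqrt ha, Real.mul_self_sqrt (sub_nonneg.2 hab),
    Real.mul_self_sqrt (sub_nonneg.2 hb), add_assoc]
  congr 2 <;> simp only [eq_comm]

/-- The correlation functional is nondecreasing on `[0, 1]`: as a kernel on the unit sphere of any
dimension it is positive semidefinite, and it is tested against two large groups of vectors with
inner products `b` inside and `a` across the groups. -/
lemma gaussianCorr_mono {κ : Type*} [Fintype κ] {f : (κ → ℝ) → ℝ} (hf : Measurable f)
    (hf2 : MemLp f 2 (gaussianVector κ)) {a b : ℝ} (ha : 0 ≤ a) (hab : a ≤ b) (hb : b ≤ 1) :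
    gaussianCorr f a ≤ gaussianCorr f b := by
  -- the diagonal terms of the quadratic form are of order `N`, the others of order `N ^ 2`
  have key : ∀ N : ℕ, 0 < N →
      N * (gaussianCorr f a - gaussianCorr f b) ≤ gaussianCorr f 1 - gaussianCorr f b := by
    intro N hN
    have hunit : ∀ p : Bool × Fin N, clusterVec a b p ⬝ᵥ clusterVec a b p = 1 := by
      intro p; rw [clusterVec_dotProduct ha hab hb]; simp
    let σ : Bool × Fin N → ℝ := fun p => if p.1 then 1 else -1
    let V : Bool × Fin N → (κ → ClusterCoord N → ℝ) → ℝ := fun p A =>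
      f (Matrix.mulVec (Matrix.of A) (clusterVec a b p))
    have hV : ∀ p, MemLp (V p) 2 (gaussianRect κ (ClusterCoord N)) := fun p =>
      memLp_comp_mulVec hf2 (hunit p)
    have h0 : 0 ≤ ∫ A, (∑ p, σ p * V p A) * (∑ p, σ p * V p A)
        ∂gaussianRect κ (ClusterCoord N) :=
      integral_nonneg fun A => mul_self_nonneg _
    have h1 : ∫ A, (∑ p, σ p * V p A) * (∑ p, σ p * V p A) ∂gaussianRect κ (ClusterCoord N) =
        ∑ p, ∑ q, σ p * σ q * gaussianCorr f (clusterVec a b p ⬝ᵥ clusterVec a b q) := by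
      simp_rw [Finset.sum_mul_sum]
      have hi : ∀ p q, Integrable (fun A => σ p * V p A * (σ q * V q A))
          (gaussianRect κ (ClusterCoord N)) := by
        intro p q
        have := ((hV p).integrable_mul (hV q)).const_mul (σ p * σ q)
        refine this.congr (Filter.Eventually.of_forall fun A => ?_)
        simp only [Pi.mul_apply]; ring
      rw [integral_finsetSum _ fun p _ => integrable_finsetSum _ fun q _ => hi p q]
      refine Finset.sum_congr rfl fun p _ => ?_
      rw [integral_finsetSum _ fun q _ => hi p q]
      refine Finset.sum_congr rfl fun q _ => ?_
      rw [← integral_mulVec_mul_mulVec hf (hunit p) (hunit q), ← integral_const_mul]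
      refine integral_congr_ae (Filter.Eventually.of_forall fun A => ?_)
      simp only [V]; ring
    have h2 : ∀ p q : Bool × Fin N,
        gaussianCorr f (clusterVec a b p ⬝ᵥ clusterVec a b q) =
          gaussianCorr f a + (if p.1 = q.1 then gaussianCorr f b - gaussianCorr f a else 0) +
            (if p = q then gaussianCorr f 1 - gaussianCorr f b else 0) := by
      intro p q
      rw [clusterVec_dotProduct ha hab hb]
      by_cases h : p = q
      · subst h; simp
      · by_cases h' : p.1 = q.1 <;> simp [h, h']
    rw [h1] at h0
    simp_rw [h2, mul_add, mul_ite, mul_zero, Finset.sum_add_distrib, Finset.sum_ite_eq] at h0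
    simp only [Fintype.sum_prod_type, Fintype.sum_bool, σ] at h0
    simp at h0
    have hN' : (0 : ℝ) < N := by exact_mod_cast hN
    nlinarith
  by_contra! hlt
  obtain ⟨N, hN⟩ := exists_nat_gt
    ((gaussianCorr f 1 - gaussianCorr f b) / (gaussianCorr f a - gaussianCorr f b))
  have hpos : 0 < gaussianCorr f a - gaussianCorr f b := sub_pos.2 hlt
  rw [div_lt_iff₀ hpos] at hN
  have := key (N + 1) (Nat.succ_pos N)
  push_cast at this
  nlinarith

lemma measurePreserving_eval_gaussianVector {κ : Type*} [Fintype κ] (i : κ) :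
    MeasurePreserving (fun y : κ → ℝ => y i) (gaussianVector κ) (gaussianReal 0 1) :=
  measurePreserving_eval (fun _ : κ => gaussianReal 0 1) i

lemma memLp_eval_gaussianVector {κ : Type*} [Fintype κ] (i : κ) :
    MemLp (fun y : κ → ℝ => y i) 2 (gaussianVector κ) :=
  (memLp_id_gaussianReal' (μ := 0) (v := 1) 2 (by simp)).comp_measurePreserving
    (measurePreserving_eval_gaussianVector i)

lemma integral_eval_mul_eval_gaussianVector {κ : Type*} [Fintype κ] (i : κ) :
    ∫ y : κ → ℝ, y i * y i ∂gaussianVector κ = 1 := by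
  have h := (measurePreserving_eval_gaussianVector (κ := κ) i).map_eq
  have h1 : ∫ z : ℝ, z * z ∂gaussianReal 0 1 = 1 := by
    have h2 := variance_id_gaussianReal (μ := 0) (v := 1)
    rw [variance_eq_integral (by fun_prop)] at h2
    simpa [integral_id_gaussianReal, sq] using h2
  rw [← h, integral_map (measurable_pi_apply i).aemeasurable (by fun_prop)] at h1
  exact h1

/-- A linear functional of `Y` only sees the component along `X` of `Y`: the orthogonal component
is symmetric given `X`. -/
lemma integral_mulVec_mul_eval {κ : Type*} [Fintype κ] {f : (κ → ℝ) → ℝ}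
    (hf : Measurable f) (hf2 : MemLp f 2 (gaussianVector κ)) (i : κ) (α β : ℝ) :
    ∫ A, f (Matrix.mulVec (Matrix.of A) ![1, 0]) * Matrix.mulVec (Matrix.of A) ![α, β] i
      ∂gaussianRect κ (Fin 2) = α * ∫ y, f y * y i ∂gaussianVector κ := by
  have e0 : ![(1 : ℝ), 0] ⬝ᵥ ![1, 0] = 1 := by simp
  have e1 : ![(0 : ℝ), 1] ⬝ᵥ ![0, 1] = 1 := by simp
  have hfe := memLp_comp_mulVec hf2 e0
  have h0 := memLp_comp_mulVec (memLp_eval_gaussianVector i) e0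
  have h1 := memLp_comp_mulVec (memLp_eval_gaussianVector i) e1
  have hsplit : ∀ A : κ → Fin 2 → ℝ,
      f (Matrix.mulVec (Matrix.of A) ![1, 0]) * Matrix.mulVec (Matrix.of A) ![α, β] i =
        α * (f (Matrix.mulVec (Matrix.of A) ![1, 0]) * Matrix.mulVec (Matrix.of A) ![1, 0] i) +
        β * (f (Matrix.mulVec (Matrix.of A) ![1, 0]) *
          Matrix.mulVec (Matrix.of A) ![0, 1] i) := by
    intro A
    simp only [Matrix.mulVec, dotProduct, Fin.sum_univ_two, Matrix.of_apply,
      Matrix.cons_val_zero, Matrix.cons_val_one]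
    ring
  simp_rw [hsplit]
  -- replacing the second vector by its negative does not change the Gram matrix
  have hz : ∫ A, f (Matrix.mulVec (Matrix.of A) ![1, 0]) * Matrix.mulVec (Matrix.of A) ![0, 1] i
      ∂gaussianRect κ (Fin 2) = 0 := by
    have h := integral_mulVec_pair_congr (κ := κ) (x := ![(1 : ℝ), 0]) (y := ![0, 1])
      (x' := ![(1 : ℝ), 0]) (y' := -![0, 1]) (F := fun a b => f a * b i) rfl (by simp) (by simp)
      ((hf.comp measurable_fst).mul ((measurable_pi_apply i).comp measurable_snd))
    simp only [Matrix.mulVec_neg, Pi.neg_apply, mul_neg, integral_neg] at h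
    linarith
  have hx : ∫ A, f (Matrix.mulVec (Matrix.of A) ![1, 0]) * Matrix.mulVec (Matrix.of A) ![1, 0] i
      ∂gaussianRect κ (Fin 2) = ∫ y, f y * y i ∂gaussianVector κ := by
    rw [← (measurePreserving_mulVec (κ := κ) e0).map_eq,
      integral_map (measurePreserving_mulVec e0).measurable.aemeasurable]
    exact (hf.mul (measurable_pi_apply i)).aestronglyMeasurable
  rw [integral_add, integral_const_mul, integral_const_mul, hz, hx, mul_zero, add_zero]
  · exact (hfe.integrable_mul h0).const_mul α
  · exact (hfe.integrable_mul h1).const_mul β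

/-- Subtracting from `f` its projection to the `i`-th coordinate removes the corresponding linear
term of the correlation functional. -/
lemma gaussianCorr_sub_linear {κ : Type*} [Fintype κ] {f : (κ → ℝ) → ℝ}
    (hf : Measurable f) (hf2 : MemLp f 2 (gaussianVector κ)) (i : κ) {α : ℝ} (hα : α ^ 2 ≤ 1) :
    gaussianCorr (fun y => f y - (∫ y, f y * y i ∂gaussianVector κ) * y i) α =
      gaussianCorr f α - (∫ y, f y * y i ∂gaussianVector κ) ^ 2 * α := by
  set m := ∫ y, f y * y i ∂gaussianVector κ with hm
  have e0 : ![(1 : ℝ), 0] ⬝ᵥ ![1, 0] = 1 := by simp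
  have eα := cos_sin_dotProduct_self hα
  have hf0 := memLp_comp_mulVec hf2 e0
  have hfα := memLp_comp_mulVec hf2 eα
  have h0 := memLp_comp_mulVec (memLp_eval_gaussianVector i) e0
  have hα := memLp_comp_mulVec (memLp_eval_gaussianVector i) eα
  have c1 := integral_mulVec_mul_eval hf hf2 i α (√(1 - α ^ 2))
  have c2 := integral_mulVec_mul_eval (measurable_pi_apply i) (memLp_eval_gaussianVector i) i α
    (√(1 - α ^ 2))
  rw [integral_eval_mul_eval_gaussianVector, mul_one] at c2
  -- exchanging the two vectors does not change their Gram matrix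
  have c3 := integral_mulVec_pair_congr (κ := κ) (x := ![(1 : ℝ), 0]) (y := ![α, √(1 - α ^ 2)])
    (x' := ![α, √(1 - α ^ 2)]) (y' := ![(1 : ℝ), 0]) (F := fun a b => f a * b i)
    (e0.trans eα.symm) (dotProduct_comm _ _) (eα.trans e0.symm)
    ((hf.comp measurable_fst).mul ((measurable_pi_apply i).comp measurable_snd))
  rw [c1, ← hm] at c3
  have hexp : ∀ A : κ → Fin 2 → ℝ,
      (f (Matrix.mulVec (Matrix.of A) ![1, 0]) - m * Matrix.mulVec (Matrix.of A) ![1, 0] i) *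
        (f (Matrix.mulVec (Matrix.of A) ![α, √(1 - α ^ 2)]) -
          m * Matrix.mulVec (Matrix.of A) ![α, √(1 - α ^ 2)] i) =
      (f (Matrix.mulVec (Matrix.of A) ![1, 0]) *
          f (Matrix.mulVec (Matrix.of A) ![α, √(1 - α ^ 2)]) -
        m * (f (Matrix.mulVec (Matrix.of A) ![1, 0]) *
          Matrix.mulVec (Matrix.of A) ![α, √(1 - α ^ 2)] i)) -
      (m * (f (Matrix.mulVec (Matrix.of A) ![α, √(1 - α ^ 2)]) *
          Matrix.mulVec (Matrix.of A) ![1, 0] i) -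
        m ^ 2 * (Matrix.mulVec (Matrix.of A) ![1, 0] i *
          Matrix.mulVec (Matrix.of A) ![α, √(1 - α ^ 2)] i)) := by
    intro A; ring
  unfold gaussianCorr
  simp_rw [hexp]
  rw [integral_sub, integral_sub, integral_sub, integral_const_mul, integral_const_mul,
    integral_const_mul, c1, c2, ← c3]
  · ring
  · exact (hfα.integrable_mul h0).const_mul _
  · exact (h0.integrable_mul hα).const_mul _
  · exact hf0.integrable_mul hfα
  · exact (hf0.integrable_mul hα).const_mul _
  · exact (hf0.integrable_mul hfα).sub ((hf0.integrable_mul hα).const_mul _)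
  · exact ((hfα.integrable_mul h0).const_mul _).sub ((h0.integrable_mul hα).const_mul _)

/-- The first-order Hermite coefficients of `f` bound the growth of its correlation functional
from below. -/
lemma gaussianCorr_gap {κ : Type*} [Fintype κ] {f : (κ → ℝ) → ℝ} (hf : Measurable f)
    (hf2 : MemLp f 2 (gaussianVector κ)) (i : κ) {a b : ℝ} (ha : 0 ≤ a) (hab : a ≤ b)
    (hb : b ≤ 1) :
    (∫ y, f y * y i ∂gaussianVector κ) ^ 2 * (b - a) ≤ gaussianCorr f b - gaussianCorr f a := by
  have h := gaussianCorr_mono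
    (f := fun y => f y - (∫ y, f y * y i ∂gaussianVector κ) * y i)
    (hf.sub ((measurable_pi_apply i).const_mul _))
    (hf2.sub ((memLp_eval_gaussianVector i).const_mul _)) ha hab hb
  rw [gaussianCorr_sub_linear hf hf2 i (by nlinarith),
    gaussianCorr_sub_linear hf hf2 i (by nlinarith)] at h
  linarith

/-! ### Collision probabilities of cross-polytope hashing -/

/-- The vertex of the cross-polytope that is chosen as nearest to `y / ‖y‖`. -/
def nearestVertex {κ : Type*} [Fintype κ] [Nonempty κ] (y : κ → ℝ) : κ × Bool :=
  Classical.choose (exists_nearest_vertex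
    (‖(WithLp.toLp 2 y : EuclideanSpace ℝ κ)‖⁻¹ • (WithLp.toLp 2 y : EuclideanSpace ℝ κ)))

lemma crossPolytopeHash_eq {κ : Type*} [Fintype κ] [Nonempty κ] (A : κ → κ → ℝ)
    (x : EuclideanSpace ℝ κ) :
    crossPolytopeHash A x = nearestVertex (Matrix.mulVec (Matrix.of A) x.ofLp) := rfl

lemma nearestVertex_smul {κ : Type*} [Fintype κ] [Nonempty κ] {r : ℝ} (hr : 0 < r) (y : κ → ℝ) :
    nearestVertex (r • y) = nearestVertex y := by
  have h : ‖(WithLp.toLp 2 (r • y) : EuclideanSpace ℝ κ)‖⁻¹ •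
      (WithLp.toLp 2 (r • y) : EuclideanSpace ℝ κ) =
      ‖(WithLp.toLp 2 y : EuclideanSpace ℝ κ)‖⁻¹ • (WithLp.toLp 2 y : EuclideanSpace ℝ κ) := by
    rw [WithLp.toLp_smul, norm_smul, Real.norm_of_nonneg hr.le, smul_smul, mul_inv, mul_assoc,
      mul_comm _ r, ← mul_assoc, inv_mul_cancel₀ hr.ne', one_mul]
  unfold nearestVertex
  simp only [h]

/-- Ties do not spoil measurability: the chosen vertex is a function of the set of all nearest
vertices. -/
lemma measurableSet_nearestVertex_eq {κ : Type*} [Fintype κ] [Nonempty κ] (v : κ × Bool) :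
    MeasurableSet {y : κ → ℝ | nearestVertex y = v} := by
  classical
  let N : (κ → ℝ) → (κ × Bool → Prop) := fun y a => ∀ b : κ × Bool,
    dist (‖(WithLp.toLp 2 y : EuclideanSpace ℝ κ)‖⁻¹ • (WithLp.toLp 2 y : EuclideanSpace ℝ κ))
      (vertex a) ≤
    dist (‖(WithLp.toLp 2 y : EuclideanSpace ℝ κ)‖⁻¹ • (WithLp.toLp 2 y : EuclideanSpace ℝ κ))
      (vertex b)
  have hN : Measurable N := by
    refine measurable_pi_iff.2 fun a => ?_
    refine Measurable.forall fun b => ?_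
    have hn : Measurable fun y : κ → ℝ => (WithLp.toLp 2 y : EuclideanSpace ℝ κ) := by fun_prop
    have hh := (hn.norm.inv).smul hn
    exact measurableSet_setOfPred.1
      (measurableSet_le (hh.dist measurable_const) (hh.dist measurable_const))
  let choice : (κ × Bool → Prop) → κ × Bool := fun P =>
    if h : ∃ a, P a then Classical.choose h else v
  have hc : ∀ y, nearestVertex y = choice (N y) := by
    intro y
    have : ∃ a, N y a := exists_nearest_vertex _
    simp only [choice, dif_pos this]
    rfl
  have : {y : κ → ℝ | nearestVertex y = v} = N ⁻¹' {P | choice P = v} := by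
    ext y; simp [hc]
  rw [this]
  exact hN (Set.toFinite _).measurableSet

/-- The sign of a vertex of the cross-polytope. -/
def vertexSign (b : Bool) : ℝ := if b then 1 else -1

lemma sq_dist_vertex {κ : Type*} [Fintype κ] (y : EuclideanSpace ℝ κ) (a : κ × Bool) :
    dist y (vertex a) ^ 2 = ‖y‖ ^ 2 - 2 * (vertexSign a.2 * y a.1) + 1 := by
  classical
  have hs : ‖vertex a‖ = 1 := by
    unfold vertex; split_ifs <;> simp
  have hi : inner ℝ y (vertex a) = vertexSign a.2 * y a.1 := by
    unfold vertex vertexSign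
    rw [EuclideanSpace.inner_single_right]; simp
  rw [dist_eq_norm, norm_sub_sq_real, hs, hi]; norm_num

lemma abs_le_vertexSign_mul {κ : Type*} [Fintype κ] [Nonempty κ] (y : κ → ℝ) (j : κ) :
    |y j| ≤ vertexSign (nearestVertex y).2 * y (nearestVertex y).1 := by
  set z : EuclideanSpace ℝ κ := WithLp.toLp 2 y with hz
  have hnear : ∀ b, dist (‖z‖⁻¹ • z) (vertex (nearestVertex y)) ≤ dist (‖z‖⁻¹ • z) (vertex b) :=
    Classical.choose_spec (exists_nearest_vertex (‖z‖⁻¹ • z))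
  rcases eq_or_ne y 0 with h0 | h0
  · simp [h0]
  have hzpos : 0 < ‖z‖ := by
    rw [norm_pos_iff]
    intro h; apply h0
    rw [hz] at h
    exact (WithLp.toLp_eq_zero 2).1 h
  have hcmp : ∀ b : κ × Bool, vertexSign b.2 * y b.1 ≤
      vertexSign (nearestVertex y).2 * y (nearestVertex y).1 := by
    intro b
    have h := pow_le_pow_left₀ dist_nonneg (hnear b) 2
    rw [sq_dist_vertex, sq_dist_vertex] at h
    simp only [PiLp.smul_apply, smul_eq_mul, hz] at h
    have h' : ‖z‖⁻¹ * (vertexSign b.2 * y b.1) ≤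
        ‖z‖⁻¹ * (vertexSign (nearestVertex y).2 * y (nearestVertex y).1) := by
      simp only [hz]; linarith
    exact le_of_mul_le_mul_left h' (inv_pos.2 hzpos)
  rcases abs_cases (y j) with h | h
  · have := hcmp (j, true); simp [vertexSign] at this ⊢; simpa [h.1] using this
  · have := hcmp (j, false); simp [vertexSign] at this ⊢; simpa [h.1] using this

/-- The indicator function of the cell of points that are hashed to the vertex `v`. -/
def cellIndicator {κ : Type*} [Fintype κ] [Nonempty κ] (v : κ × Bool) : (κ → ℝ) → ℝ :=
  Set.indicator {y | nearestVertex y = v} (fun _ => 1)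

lemma measurable_cellIndicator {κ : Type*} [Fintype κ] [Nonempty κ] (v : κ × Bool) :
    Measurable (cellIndicator v) :=
  measurable_const.indicator (measurableSet_nearestVertex_eq v)

lemma memLp_cellIndicator {κ : Type*} [Fintype κ] [Nonempty κ] (v : κ × Bool) :
    MemLp (cellIndicator v) 2 (gaussianVector κ) :=
  memLp_indicator_const 2 (measurableSet_nearestVertex_eq v) 1 (Or.inr (measure_ne_top _ _))

open Classical in
lemma cellIndicator_apply {κ : Type*} [Fintype κ] [Nonempty κ] (v : κ × Bool) (y : κ → ℝ) :
    cellIndicator v y = if nearestVertex y = v then 1 else 0 := by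
  simp [cellIndicator, Set.indicator_apply]

/-- The first absolute moment of the standard Gaussian law. -/
def gaussianAbsMoment : ℝ := ∫ z, |z| ∂gaussianReal 0 1

lemma gaussianAbsMoment_pos : 0 < gaussianAbsMoment := by
  have hint : Integrable (fun z : ℝ => |z|) (gaussianReal 0 1) :=
    ((memLp_id_gaussianReal' (μ := 0) (v := 1) 1 (by simp)).integrable le_rfl).abs
  refine (integral_pos_iff_support_of_nonneg (fun z => abs_nonneg z) hint).2 ?_
  have hs : Function.support (fun z : ℝ => |z|) = {0}ᶜ := by ext; simp
  have := nullSingletonClass_gaussianReal (μ := 0) (v := 1) one_ne_zero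
  rw [hs, prob_compl_eq_one_sub (measurableSet_singleton 0), measure_singleton]
  simp

/-- The cells together have a first-order Hermite weight bounded below: the nearest vertex to `y`
sees a coordinate of `y` of the largest modulus. -/
lemma sq_gaussianAbsMoment_le {κ : Type*} [Fintype κ] [Nonempty κ] :
    gaussianAbsMoment ^ 2 ≤ 2 * Fintype.card κ *
      ∑ v : κ × Bool, (∫ y, cellIndicator v y * y v.1 ∂gaussianVector κ) ^ 2 := by
  classical
  obtain ⟨j⟩ := ‹Nonempty κ›
  have : Nonempty κ := ⟨j⟩
  have hi : ∀ v : κ × Bool, Integrable (fun y => cellIndicator v y * y v.1) (gaussianVector κ) :=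
    fun v => (memLp_cellIndicator v).integrable_mul (memLp_eval_gaussianVector v.1)
  have h1 : gaussianAbsMoment ≤
      ∑ v : κ × Bool, vertexSign v.2 * ∫ y, cellIndicator v y * y v.1 ∂gaussianVector κ := by
    have h2 : gaussianAbsMoment = ∫ y : κ → ℝ, |y j| ∂gaussianVector κ := by
      rw [gaussianAbsMoment, ← (measurePreserving_eval_gaussianVector j).map_eq,
        integral_map (measurable_pi_apply j).aemeasurable (by fun_prop)]
    rw [h2]
    simp_rw [← integral_const_mul]
    rw [← integral_finsetSum _ fun v _ => (hi v).const_mul _]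
    refine integral_mono ((memLp_eval_gaussianVector j).integrable (by norm_num)).abs
      (integrable_finsetSum _ fun v _ => (hi v).const_mul _) fun y => ?_
    simp only [cellIndicator_apply, ite_mul, one_mul, zero_mul, mul_ite, mul_zero]
    rw [Finset.sum_ite_eq]
    simpa using abs_le_vertexSign_mul y j
  have h3 := Finset.sum_mul_sq_le_sq_mul_sq Finset.univ (fun v : κ × Bool => vertexSign v.2)
    (fun v => ∫ y, cellIndicator v y * y v.1 ∂gaussianVector κ)
  have h4 : ∑ v : κ × Bool, vertexSign v.2 ^ 2 = 2 * Fintype.card κ := by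
    have : ∀ v : κ × Bool, vertexSign v.2 ^ 2 = 1 := by
      intro v; unfold vertexSign; split_ifs <;> norm_num
    simp [this, mul_comm]
  rw [h4] at h3
  exact (pow_le_pow_left₀ gaussianAbsMoment_pos.le h1 2).trans h3

/-- The probability that two unit vectors with inner product `α` have the same cross-polytope
hash. -/
def hashCorr (κ : Type*) [Fintype κ] [Nonempty κ] (α : ℝ) : ℝ :=
  ∑ v : κ × Bool, gaussianCorr (cellIndicator v) α

lemma hashCorr_nonneg {κ : Type*} [Fintype κ] [Nonempty κ] (α : ℝ) : 0 ≤ hashCorr κ α :=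
  Finset.sum_nonneg fun _ _ => integral_nonneg fun _ =>
    mul_nonneg (Set.indicator_nonneg (fun _ _ => zero_le_one) _)
      (Set.indicator_nonneg (fun _ _ => zero_le_one) _)

lemma hashCorr_mono {κ : Type*} [Fintype κ] [Nonempty κ] {a b : ℝ} (ha : 0 ≤ a) (hab : a ≤ b)
    (hb : b ≤ 1) : hashCorr κ a ≤ hashCorr κ b :=
  Finset.sum_le_sum fun v _ =>
    gaussianCorr_mono (measurable_cellIndicator v) (memLp_cellIndicator v) ha hab hb

/-- A lower bound, for dimension at most `d`, on the slope of the collision probability as a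
function of the inner product. -/
def hashSlope (d : ℕ) : ℝ := gaussianAbsMoment ^ 2 / (2 * d)

lemma hashCorr_gap {κ : Type*} [Fintype κ] [Nonempty κ] {a b : ℝ} (ha : 0 ≤ a) (hab : a ≤ b)
    (hb : b ≤ 1) {d : ℕ} (hd : Fintype.card κ ≤ d) :
    hashSlope d * (b - a) ≤ hashCorr κ b - hashCorr κ a := by
  set M := ∑ v : κ × Bool, (∫ y, cellIndicator v y * y v.1 ∂gaussianVector κ) ^ 2 with hM
  have hM0 : 0 ≤ M := Finset.sum_nonneg fun _ _ => sq_nonneg _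
  have h1 : M * (b - a) ≤ hashCorr κ b - hashCorr κ a := by
    rw [hM, hashCorr, hashCorr, ← Finset.sum_sub_distrib, Finset.sum_mul]
    exact Finset.sum_le_sum fun v _ =>
      gaussianCorr_gap (measurable_cellIndicator v) (memLp_cellIndicator v) v.1 ha hab hb
  have h2 : hashSlope d ≤ M := by
    have hdc : (Fintype.card κ : ℝ) ≤ d := by exact_mod_cast hd
    have hpos : (0 : ℝ) < Fintype.card κ := by exact_mod_cast Fintype.card_pos
    rw [hashSlope, div_le_iff₀ (by linarith)]
    have := sq_gaussianAbsMoment_le (κ := κ)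
    rw [← hM] at this
    nlinarith [mul_nonneg hM0 (sub_nonneg.2 hdc)]
  exact (mul_le_mul_of_nonneg_right h2 (sub_nonneg.2 hab)).trans h1

/-- The event that two vectors have the same hash. -/
def collision {κ : Type*} [Fintype κ] [Nonempty κ] (x y : EuclideanSpace ℝ κ) :
    Set (κ → κ → ℝ) :=
  {A | crossPolytopeHash A x = crossPolytopeHash A y}

lemma measurableSet_collision {κ : Type*} [Fintype κ] [Nonempty κ] (x y : EuclideanSpace ℝ κ) :
    MeasurableSet (collision x y) := by
  have h : collision x y = ⋃ v : κ × Bool,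
      (fun A : κ → κ → ℝ => Matrix.mulVec (Matrix.of A) x.ofLp) ⁻¹' {z | nearestVertex z = v} ∩
      (fun A : κ → κ → ℝ => Matrix.mulVec (Matrix.of A) y.ofLp) ⁻¹' {z | nearestVertex z = v} := by
    ext A
    simp [collision, crossPolytopeHash_eq, eq_comm]
  rw [h]
  exact MeasurableSet.iUnion fun v =>
    (measurable_mulVec_const _ (measurableSet_nearestVertex_eq v)).inter
      (measurable_mulVec_const _ (measurableSet_nearestVertex_eq v))

instance {κ : Type*} [Fintype κ] : IsProbabilityMeasure (gaussianMatrix κ) := by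
  unfold gaussianMatrix; infer_instance

lemma real_collision_of_norm_eq_one {κ : Type*} [Fintype κ] [Nonempty κ]
    {x y : EuclideanSpace ℝ κ} (hx : ‖x‖ = 1) (hy : ‖y‖ = 1) :
    (gaussianMatrix κ).real (collision x y) = hashCorr κ (inner ℝ x y) := by
  classical
  have hdot : ∀ a b : EuclideanSpace ℝ κ, inner ℝ a b = a.ofLp ⬝ᵥ b.ofLp := by
    intro a b
    rw [EuclideanSpace.inner_eq_star_dotProduct, dotProduct_comm]; simp
  have hx' : x.ofLp ⬝ᵥ x.ofLp = 1 := by rw [← hdot, real_inner_self_eq_norm_sq, hx]; norm_num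
  have hy' : y.ofLp ⬝ᵥ y.ofLp = 1 := by rw [← hdot, real_inner_self_eq_norm_sq, hy]; norm_num
  rw [hdot, hashCorr]
  simp_rw [← integral_mulVec_mul_mulVec (measurable_cellIndicator _) hx' hy']
  have hi : ∀ v : κ × Bool, Integrable (fun A : κ → κ → ℝ =>
      cellIndicator v (Matrix.mulVec (Matrix.of A) x.ofLp) *
        cellIndicator v (Matrix.mulVec (Matrix.of A) y.ofLp)) (gaussianRect κ κ) := fun v =>
    (memLp_comp_mulVec (memLp_cellIndicator v) hx').integrable_mul
      (memLp_comp_mulVec (memLp_cellIndicator v) hy')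
  rw [← integral_finsetSum _ fun v _ => hi v,
    ← integral_indicator_one (measurableSet_collision x y)]
  refine integral_congr_ae (Filter.Eventually.of_forall fun A => ?_)
  simp only [cellIndicator_apply, collision, Set.indicator_apply, Set.mem_ofPred_eq,
    crossPolytopeHash_eq, ite_mul, one_mul, zero_mul, Pi.one_apply]
  rw [Finset.sum_ite_eq]
  simp [eq_comm]

/-- The collision probability depends only on the angle. -/
lemma real_collision {κ : Type*} [Fintype κ] [Nonempty κ] {x y : EuclideanSpace ℝ κ}
    (hx : x ≠ 0) (hy : y ≠ 0) :
    (gaussianMatrix κ).real (collision x y) = hashCorr κ (inner ℝ x y / (‖x‖ * ‖y‖)) := by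
  have hx' := norm_pos_iff.2 hx
  have hy' := norm_pos_iff.2 hy
  have hs : ∀ {z : EuclideanSpace ℝ κ}, 0 < ‖z‖ → ∀ A : κ → κ → ℝ,
      crossPolytopeHash A (‖z‖⁻¹ • z) = crossPolytopeHash A z := by
    intro z hz A
    rw [crossPolytopeHash_eq, crossPolytopeHash_eq, WithLp.ofLp_smul, Matrix.mulVec_smul,
      nearestVertex_smul (inv_pos.2 hz)]
  have h : collision x y = collision (‖x‖⁻¹ • x) (‖y‖⁻¹ • y) := by
    simp only [collision, hs hx', hs hy']
  have hn : ∀ {z : EuclideanSpace ℝ κ}, 0 < ‖z‖ → ‖‖z‖⁻¹ • z‖ = 1 := by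
    intro z hz
    rw [norm_smul, norm_inv, norm_norm, inv_mul_cancel₀ hz.ne']
  rw [h, real_collision_of_norm_eq_one (hn hx') (hn hy')]
  congr 1
  rw [inner_smul_left, inner_smul_right]
  simp
  field_simp

/-! ### Similarity and angles of the transformed vectors -/

section Geometry

variable {Pt : Type u} {Cell : Type v} {disc : Discretization Pt Cell}
  {cost : STEdge Cell → ℝ} {E : Finset (STEdge Cell)} {prm : Params} {q r : Ride Pt}

lemma edges_nonempty (disc : Discretization Pt Cell) (r : Ride Pt) : (disc.edges r).Nonempty := by
  classical
  obtain ⟨l, hl, -⟩ := r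
  match l, hl with
  | a :: b :: l, _ =>
    exact ⟨(disc.node a, disc.node b), by simp [Discretization.edges, Discretization.nodes]⟩

lemma sum_ite_mem_of_subset {X : Finset (STEdge Cell)} [DecidablePred (· ∈ X)] (hX : X ⊆ E)
    (g : STEdge Cell → ℝ) :
    ∑ e : E, (if (e : STEdge Cell) ∈ X then g e else 0) = ∑ e ∈ X, g e := by
  classical
  rw [Finset.sum_coe_sort E (fun e => if e ∈ X then g e else 0), ← Finset.sum_filter]
  congr 1
  ext e
  simp only [Finset.mem_filter]
  exact ⟨fun h => h.2, fun h => ⟨hX h, h⟩⟩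

lemma norm_queryVec (hq : disc.edges q ⊆ E) :
    ‖queryVec disc E q‖ = √((disc.edges q).card : ℝ) := by
  classical
  rw [EuclideanSpace.norm_eq]
  congr 1
  simp only [queryVec, Real.norm_eq_abs, sq_abs, ite_pow, one_pow, ne_eq, OfNat.ofNat_ne_zero,
    not_false_eq_true, zero_pow]
  rw [sum_ite_mem_of_subset hq (fun _ => 1)]
  simp

lemma norm_queryVec_pos (hq : disc.edges q ⊆ E) : 0 < ‖queryVec disc E q‖ := by
  rw [norm_queryVec hq]
  exact Real.sqrt_pos.2 (by exact_mod_cast (edges_nonempty disc q).card_pos)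

lemma inner_prepVec_queryVec (hq : disc.edges q ⊆ E) :
    inner ℝ (prepVec disc cost E r) (queryVec disc E q) = similarity disc cost q r := by
  classical
  have hsub : disc.edges q ∩ disc.edges r ⊆ E := Finset.inter_subset_left.trans hq
  rw [similarity, ← sum_ite_mem_of_subset hsub, PiLp.inner_apply]
  refine Finset.sum_congr rfl fun e _ => ?_
  by_cases h1 : (e : STEdge Cell) ∈ disc.edges q <;>
    by_cases h2 : (e : STEdge Cell) ∈ disc.edges r <;> simp [prepVec, queryVec, h1, h2]

lemma sq_norm_scaledPrep_le {D : ℕ} {W : ℝ} (hD : E.card ≤ D)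
    (hcost : ∀ e ∈ E, 0 ≤ cost e ∧ cost e ≤ W) :
    ‖scaledPrep disc cost E prm r‖ ^ 2 ≤ prm.scale ^ 2 * (D * W ^ 2) := by
  classical
  rw [scaledPrep, norm_smul, mul_pow, Real.norm_eq_abs, sq_abs]
  refine mul_le_mul_of_nonneg_left ?_ (sq_nonneg _)
  rw [EuclideanSpace.norm_sq_eq]
  have h : ∀ e : E, ‖prepVec disc cost E r e‖ ^ 2 ≤ W ^ 2 := by
    intro e
    obtain ⟨h0, h1⟩ := hcost e e.2
    simp only [prepVec, Real.norm_eq_abs, sq_abs]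
    split_ifs
    · exact pow_le_pow_left₀ h0 h1 2
    · simpa using sq_nonneg W
  refine (Finset.sum_le_card_nsmul _ _ _ fun e _ => h e).trans ?_
  rw [nsmul_eq_mul, Finset.card_univ, Fintype.card_coe]
  exact mul_le_mul_of_nonneg_right (by exact_mod_cast hD) (sq_nonneg W)

lemma sq_norm_prepTransform_two {ι : Type*} [Fintype ι] (x : EuclideanSpace ℝ ι) :
    ‖prepTransform 2 x‖ ^ 2 = 1 / 2 + (‖x‖ ^ 2) ^ 4 := by
  rw [EuclideanSpace.norm_sq_eq, Fintype.sum_sum_type]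
  simp only [prepTransform, Sum.elim_inl, Sum.elim_inr, Fin.sum_univ_two]
  rw [← EuclideanSpace.norm_sq_eq]
  simp only [Real.norm_eq_abs, sq_abs, Fin.val_zero, Fin.val_one]
  ring

lemma norm_queryTransform {ι : Type*} [Fintype ι] (m : ℕ) (x : EuclideanSpace ℝ ι) :
    ‖queryTransform m x‖ = ‖x‖ := by
  rw [EuclideanSpace.norm_eq, EuclideanSpace.norm_eq, Fintype.sum_sum_type]
  simp [queryTransform]

lemma inner_prepTransform_queryTransform {ι : Type*} [Fintype ι] (m : ℕ)
    (x y : EuclideanSpace ℝ ι) :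
    inner ℝ (prepTransform m x) (queryTransform m y) = inner ℝ x y := by
  rw [PiLp.inner_apply, PiLp.inner_apply, Fintype.sum_sum_type]
  simp [queryTransform, prepTransform]

lemma norm_queryPoint (hq : disc.edges q ⊆ E) : ‖(queryPoint disc E q).val‖ = 1 := by
  rw [queryPoint, norm_queryTransform, norm_smul, norm_inv, norm_norm,
    inv_mul_cancel₀ (norm_queryVec_pos hq).ne']

/-- The cosine of the angle between a transformed ride and a transformed query. -/
def pointCos (disc : Discretization Pt Cell) (cost : STEdge Cell → ℝ)
    (E : Finset (STEdge Cell)) (prm : Params) (q r : Ride Pt) : ℝ :=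
  inner ℝ (prepPoint disc cost E prm r).val (queryPoint disc E q).val /
    (‖(prepPoint disc cost E prm r).val‖ * ‖(queryPoint disc E q).val‖)

lemma pointCos_eq (hq : disc.edges q ⊆ E) :
    pointCos disc cost E prm q r = prm.scale * similarity disc cost q r /
      (√((disc.edges q).card : ℝ) * ‖(prepPoint disc cost E prm r).val‖) := by
  rw [pointCos, norm_queryPoint hq, mul_one, prepPoint, queryPoint,
    inner_prepTransform_queryTransform, scaledPrep, inner_smul_left, inner_smul_right,
    inner_prepVec_queryVec hq, norm_queryVec hq]
  simp only [conj_trivial]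
  rw [mul_left_comm, ← div_eq_inv_mul, div_div]

lemma sqrt_inv_two_le_norm_prepPoint : √(2⁻¹) ≤ ‖(prepPoint disc cost E prm r).val‖ := by
  apply Real.sqrt_le_iff.2 ⟨norm_nonneg _, ?_⟩
  rw [prepPoint, sq_norm_prepTransform_two]
  have : 0 ≤ (‖scaledPrep disc cost E prm r‖ ^ 2) ^ 4 := by positivity
  linarith

lemma norm_prepPoint_pos : 0 < ‖(prepPoint disc cost E prm r).val‖ :=
  (Real.sqrt_pos.2 (by norm_num)).trans_le sqrt_inv_two_le_norm_prepPoint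

lemma norm_prepPoint_le {c : ℝ} (hc0 : 0 < c) (hc1 : c < 1)
    (h : ‖scaledPrep disc cost E prm r‖ ^ 2 ≤ (1 - c) / 4) :
    ‖(prepPoint disc cost E prm r).val‖ ≤ √2 / (1 + c) := by
  rw [le_div_iff₀ (by linarith)]
  apply Real.le_sqrt_of_sq_le
  rw [mul_pow, prepPoint, sq_norm_prepTransform_two]
  set z := ‖scaledPrep disc cost E prm r‖ ^ 2 with hz
  have hz0 : 0 ≤ z := sq_nonneg _
  have h4 : z ^ 4 ≤ z := by
    have : z ^ 4 ≤ z ^ 1 := pow_le_pow_of_le_one hz0 (by linarith) (by norm_num)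
    simpa using this
  have h5 : (1 / 2 + z ^ 4) * (1 + c) ^ 2 ≤ (1 / 2 + (1 - c) / 4) * (1 + c) ^ 2 :=
    mul_le_mul_of_nonneg_right (by linarith) (sq_nonneg _)
  nlinarith [mul_nonneg (sub_nonneg.2 hc1.le) (show (0 : ℝ) ≤ 5 - c ^ 2 by nlinarith)]

lemma similarity_nonneg {W : ℝ} (hq : disc.edges q ⊆ E)
    (hcost : ∀ e ∈ E, 0 ≤ cost e ∧ cost e ≤ W) : 0 ≤ similarity disc cost q r := by
  classical
  exact Finset.sum_nonneg fun e he => (hcost e (hq (Finset.mem_of_mem_inter_left he))).1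

/-- The unit in which the angles of a query are measured. -/
def cosUnit (disc : Discretization Pt Cell) (scale s : ℝ) (q : Ride Pt) : ℝ :=
  scale * s / (√2 * √((disc.edges q).card : ℝ))

lemma le_pointCos_of_similar {c s : ℝ} (hc0 : 0 < c) (hc1 : c < 1) (hs : 0 < s)
    (hscale : 0 < prm.scale) (hq : disc.edges q ⊆ E)
    (h : ‖scaledPrep disc cost E prm r‖ ^ 2 ≤ (1 - c) / 4) (hsim : s ≤ similarity disc cost q r) :
    (1 + c) * cosUnit disc prm.scale s q ≤ pointCos disc cost E prm q r := by
  have hm : 0 < √((disc.edges q).card : ℝ) := by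
    rw [← norm_queryVec hq]; exact norm_queryVec_pos hq
  have h2 := norm_prepPoint_le hc0 hc1 h
  have h3 := norm_prepPoint_pos (disc := disc) (cost := cost) (E := E) (prm := prm) (r := r)
  have hc : 0 < 1 + c := by linarith
  rw [pointCos_eq hq, cosUnit, le_div_iff₀ (by positivity)]
  calc (1 + c) * (prm.scale * s / (√2 * √((disc.edges q).card : ℝ))) *
        (√((disc.edges q).card : ℝ) * ‖(prepPoint disc cost E prm r).val‖)
      ≤ (1 + c) * (prm.scale * s / (√2 * √((disc.edges q).card : ℝ))) *
        (√((disc.edges q).card : ℝ) * (√2 / (1 + c))) := by gcongr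
    _ = prm.scale * s := by field_simp
    _ ≤ _ := by gcongr

lemma pointCos_le_of_dissimilar {c s : ℝ} (hscale : 0 < prm.scale) (hq : disc.edges q ⊆ E)
    (hcs : 0 < c * s) (hsim : similarity disc cost q r < c * s) :
    pointCos disc cost E prm q r ≤ 2 * c * cosUnit disc prm.scale s q := by
  have hm : 0 < √((disc.edges q).card : ℝ) := by
    rw [← norm_queryVec hq]; exact norm_queryVec_pos hq
  have h2 := sqrt_inv_two_le_norm_prepPoint
    (disc := disc) (cost := cost) (E := E) (prm := prm) (r := r)
  have h3 := norm_prepPoint_pos (disc := disc) (cost := cost) (E := E) (prm := prm) (r := r)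
  rw [pointCos_eq hq, cosUnit, div_le_iff₀ (by positivity)]
  calc prm.scale * similarity disc cost q r ≤ prm.scale * (c * s) := by gcongr
    _ = 2 * c * (prm.scale * s / (√2 * √((disc.edges q).card : ℝ))) *
        (√((disc.edges q).card : ℝ) * √(2⁻¹)) := by
      have h4 : √2 * √2 = (2 : ℝ) := Real.mul_self_sqrt (by norm_num)
      rw [Real.sqrt_inv]
      field_simp
      linear_combination c * s * h4
    _ ≤ _ := by
      have : 0 < c * (prm.scale * s) := by rw [mul_left_comm]; positivity
      have h5 : 0 ≤ 2 * c * (prm.scale * s / (√2 * √((disc.edges q).card : ℝ))) := by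
        rw [show 2 * c * (prm.scale * s / (√2 * √((disc.edges q).card : ℝ))) =
          2 * (c * (prm.scale * s)) / (√2 * √((disc.edges q).card : ℝ)) by ring]
        positivity
      gcongr

lemma pointCos_nonneg {W : ℝ} (hscale : 0 < prm.scale) (hq : disc.edges q ⊆ E)
    (hcost : ∀ e ∈ E, 0 ≤ cost e ∧ cost e ≤ W) : 0 ≤ pointCos disc cost E prm q r := by
  rw [pointCos_eq hq]
  have := similarity_nonneg (r := r) hq hcost
  positivity

lemma pointCos_le_one : pointCos disc cost E prm q r ≤ 1 :=
  (abs_le.1 (abs_real_inner_div_norm_mul_norm_le_one _ _)).2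

lemma le_cosUnit {D : ℕ} {scale s : ℝ} (hs : 0 < s) (hscale : 0 < scale)
    (hq : disc.edges q ⊆ E) (hD : E.card ≤ D) :
    scale * s / (√2 * √(D : ℝ)) ≤ cosUnit disc scale s q := by
  have hm : 0 < √((disc.edges q).card : ℝ) := by
    rw [← norm_queryVec hq]; exact norm_queryVec_pos hq
  have : ((disc.edges q).card : ℝ) ≤ D := by exact_mod_cast (Finset.card_le_card hq).trans hD
  unfold cosUnit
  gcongr

/-- The probability that a ride and a query have the same cross-polytope hash. -/
def hitProb (disc : Discretization Pt Cell) (cost : STEdge Cell → ℝ)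
    (E : Finset (STEdge Cell)) (prm : Params) (q r : Ride Pt) : ℝ :=
  (gaussianMatrix (Coord E)).real
    (collision (prepPoint disc cost E prm r).val (queryPoint disc E q).val)

lemma hitProb_eq (hq : disc.edges q ⊆ E) :
    hitProb disc cost E prm q r = hashCorr (Coord E) (pointCos disc cost E prm q r) :=
  real_collision (norm_pos_iff.1 norm_prepPoint_pos)
    (norm_pos_iff.1 (by rw [norm_queryPoint hq]; exact one_pos))

lemma card_coord_le {D : ℕ} (hD : E.card ≤ D) : Fintype.card (Coord E) ≤ D + 2 := by
  simp; omega

/-- A similar ride is hit with a probability bounded below, uniformly in all data. -/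
lemma le_hitProb_of_similar {D : ℕ} {c s : ℝ} (hc0 : 0 < c) (hc1 : c < 1) (hs : 0 < s)
    (hscale : 0 < prm.scale) (hq : disc.edges q ⊆ E) (hD : E.card ≤ D)
    (h : ‖scaledPrep disc cost E prm r‖ ^ 2 ≤ (1 - c) / 4) (hsim : s ≤ similarity disc cost q r) :
    hashSlope (D + 2) * (prm.scale * s / (√2 * √(D : ℝ))) ≤ hitProb disc cost E prm q r := by
  have h1 := le_pointCos_of_similar hc0 hc1 hs hscale hq h hsim
  have h2 := le_cosUnit hs hscale hq hD
  have h3 : 0 ≤ prm.scale * s / (√2 * √(D : ℝ)) := by positivity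
  have h4 : prm.scale * s / (√2 * √(D : ℝ)) ≤ pointCos disc cost E prm q r := by nlinarith
  have hgap := hashCorr_gap (κ := Coord E) le_rfl (h3.trans h4) pointCos_le_one (card_coord_le hD)
  rw [hitProb_eq hq]
  have h5 := hashCorr_nonneg (κ := Coord E) 0
  have h6 : 0 ≤ hashSlope (D + 2) := by unfold hashSlope; positivity
  nlinarith [mul_le_mul_of_nonneg_left h4 h6]

/-- Against the same query, dissimilar rides are hit less often than similar ones, with a margin
that is uniform in all data. -/
lemma hitProb_gap {D : ℕ} {c s W : ℝ} (hc0 : 0 < c) (hc1 : c < 1) (hs : 0 < s)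
    (hscale : 0 < prm.scale) (hq : disc.edges q ⊆ E) (hD : E.card ≤ D)
    (hcost : ∀ e ∈ E, 0 ≤ cost e ∧ cost e ≤ W) {r' : Ride Pt}
    (h : ‖scaledPrep disc cost E prm r‖ ^ 2 ≤ (1 - c) / 4) (hsim : s ≤ similarity disc cost q r)
    (hdis : similarity disc cost q r' < c * s) :
    hitProb disc cost E prm q r' ≤ hitProb disc cost E prm q r -
      hashSlope (D + 2) * ((1 - c) * (prm.scale * s / (√2 * √(D : ℝ)))) := by
  have h1 := le_pointCos_of_similar hc0 hc1 hs hscale hq h hsim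
  have h2 := le_cosUnit hs hscale hq hD
  have h3 : 0 ≤ prm.scale * s / (√2 * √(D : ℝ)) := by positivity
  have h4 := pointCos_le_of_dissimilar hscale hq (mul_pos hc0 hs) hdis
  have h5 := pointCos_nonneg (r := r') hscale hq hcost
  have h6 : (pointCos disc cost E prm q r) ≤ 1 := pointCos_le_one
  have h7 : 2 * c * cosUnit disc prm.scale s q ≤ (1 + c) * cosUnit disc prm.scale s q := by
    nlinarith
  have hgap := hashCorr_gap (κ := Coord E) (h5.trans h4) (h7.trans h1) h6 (card_coord_le hD)
  have hm := hashCorr_mono (κ := Coord E) h5 h4 (h7.trans (h1.trans h6))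
  rw [hitProb_eq hq, hitProb_eq hq]
  have h8 : 0 ≤ hashSlope (D + 2) := by unfold hashSlope; positivity
  have h9 : (1 - c) * (prm.scale * s / (√2 * √(D : ℝ))) ≤
      pointCos disc cost E prm q r - 2 * c * cosUnit disc prm.scale s q := by nlinarith
  nlinarith [mul_le_mul_of_nonneg_left h9 h8]

end Geometry

/-! ### Deterministic analysis of the algorithm -/

section Algorithm

variable {Pt : Type u} {Cell : Type v} {disc : Discretization Pt Cell}
  {cost : STEdge Cell → ℝ} {E : Finset (STEdge Cell)} {prm : Params} {n : ℕ}
  {R : Fin n → Ride Pt} {q : Ride Pt}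

/-- Steps for one concatenated hash value. -/
def hashSteps (E : Finset (STEdge Cell)) (t : ℕ) : ℕ :=
  t * (2 * (E.card + 2) ^ 2 + 2 * (E.card + 2)) + t

open Classical in
lemma foldl_insert_bucket {t : ℕ} (A : Fin t → Coord E → Coord E → ℝ)
    (x : Fin n → EuclideanSpace ℝ (Coord E)) (l : List (Fin n)) (T : Counted (Table E t n)) :
    (∀ κ, (l.foldl (fun T i =>
      let g := hashKey E A (x i)
      { val := Function.update T.val g.val (i :: T.val g.val)
        steps := T.steps + g.steps + 1 }) T).val κ =
        (l.filter fun i => (hashKey E A (x i)).val = κ).reverse ++ T.val κ) ∧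
    (l.foldl (fun T i =>
      let g := hashKey E A (x i)
      { val := Function.update T.val g.val (i :: T.val g.val)
        steps := T.steps + g.steps + 1 }) T).steps =
        T.steps + l.length * (hashSteps E t + 1) := by
  induction l generalizing T with
  | nil => simp
  | cons a l ih =>
    rw [List.foldl_cons]
    obtain ⟨h1, h2⟩ := ih { val := Function.update T.val (hashKey E A (x a)).val
                                    (a :: T.val (hashKey E A (x a)).val)
                            steps := T.steps + (hashKey E A (x a)).steps + 1 }
    refine ⟨fun κ => ?_, ?_⟩
    · rw [h1]
      by_cases h : (hashKey E A (x a)).val = κ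
      · subst h; simp
      · simp only [Function.update_of_ne (Ne.symm h)]; simp [h]
    · rw [h2, List.length_cons]
      simp only [hashKey, hashSteps]
      ring

open Classical in
lemma buildTable_val {t : ℕ} (A : Fin t → Coord E → Coord E → ℝ)
    (x : Fin n → EuclideanSpace ℝ (Coord E)) (κ : Key E t) :
    (buildTable E A x).val κ =
      ((List.finRange n).filter fun i => (hashKey E A (x i)).val = κ).reverse := by
  have h := (foldl_insert_bucket A x (List.finRange n) { val := fun _ => [], steps := 0 }).1 κ
  rw [List.append_nil] at h
  exact h

lemma buildTable_steps {t : ℕ} (A : Fin t → Coord E → Coord E → ℝ)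
    (x : Fin n → EuclideanSpace ℝ (Coord E)) :
    (buildTable E A x).steps = n * (hashSteps E t + 1) := by
  have h := (foldl_insert_bucket A x (List.finRange n) { val := fun _ => [], steps := 0 }).2
  rw [List.length_finRange, zero_add] at h
  exact h

lemma tableWords_buildTable_le {t : ℕ} (A : Fin t → Coord E → Coord E → ℝ)
    (x : Fin n → EuclideanSpace ℝ (Coord E)) :
    tableWords E (buildTable E A x).val ≤ 2 * n := by
  classical
  have h1 : ∀ κ : Key E t, ((buildTable E A x).val κ).length =
      ∑ i : Fin n, if (hashKey E A (x i)).val = κ then 1 else 0 := by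
    intro κ
    rw [buildTable_val, List.length_reverse, Finset.sum_boole, Nat.cast_id]
    rw [← List.toFinset_card_of_nodup ((List.nodup_finRange n).filter _)]
    congr 1
    ext i; simp
  have h2 : ∑ κ : Key E t, ((buildTable E A x).val κ).length = n := by
    simp_rw [h1]
    rw [Finset.sum_comm]
    simp
  calc tableWords E (buildTable E A x).val
      ≤ ∑ κ : Key E t, 2 * ((buildTable E A x).val κ).length := by
        refine Finset.sum_le_sum fun κ _ => ?_
        rcases h : (buildTable E A x).val κ with _ | ⟨a, l⟩
        · simp
        · simp; omega
    _ = 2 * n := by rw [← Finset.mul_sum, h2]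

/-- The bucket of a query in one of the tables. -/
def bucket (disc : Discretization Pt Cell) (cost : STEdge Cell → ℝ)
    (E : Finset (STEdge Cell)) (prm : Params) (R : Fin n → Ride Pt) (ω : Seed E prm)
    (q : Ride Pt) (j : Fin prm.L) : List (Fin n) :=
  (buildIndex disc cost E prm R ω).val j (hashKey E (ω j) (queryPoint disc E q).val).val

lemma nodup_bucket (ω : Seed E prm) (j : Fin prm.L) :
    (bucket disc cost E prm R ω q j).Nodup := by
  classical
  simp only [bucket, buildIndex]
  rw [buildTable_val, List.nodup_reverse]
  exact (List.nodup_finRange n).filter _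

lemma mem_bucket {ω : Seed E prm} {j : Fin prm.L} {i : Fin n} :
    i ∈ bucket disc cost E prm R ω q j ↔ ∀ l, ω j l ∈
      collision (prepPoint disc cost E prm (R i)).val (queryPoint disc E q).val := by
  classical
  simp only [bucket, buildIndex]
  rw [buildTable_val, List.mem_reverse, List.mem_filter]
  simp [hashKey, funext_iff, collision]

/-- What holds throughout a query: at most `k` rides have been found, all of them similar, and the
budget has not been exceeded. -/
def QueryState.Sound (disc : Discretization Pt Cell) (cost : STEdge Cell → ℝ) (prm : Params)
    (R : Fin n → Ride Pt) (q : Ride Pt) (st : QueryState n) : Prop :=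
  st.found.card ≤ prm.k ∧ (∀ i ∈ st.found, prm.c * prm.s ≤ similarity disc cost q (R i)) ∧
    st.dissimilar ≤ prm.budget

lemma examine_of_halted {st : QueryState n} (h : st.Halted prm) (i : Fin n) :
    examine disc cost E prm R q st i = st := by
  simp [examine, h]

lemma foldl_examine_of_halted {st : QueryState n} (h : st.Halted prm) (l : List (Fin n)) :
    l.foldl (examine disc cost E prm R q) st = st := by
  induction l with
  | nil => rfl
  | cons a l ih => rw [List.foldl_cons, examine_of_halted h, ih]

open Classical in
lemma examine_of_similar {st : QueryState n} (h : ¬ st.Halted prm) {i : Fin n}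
    (hi : prm.c * prm.s ≤ similarity disc cost q (R i)) :
    examine disc cost E prm R q st i =
      { found := insert i st.found
        dissimilar := st.dissimilar
        steps := st.steps + (2 * E.card + 3) } := by
  simp [examine, h, hi]

lemma examine_of_dissimilar {st : QueryState n} (h : ¬ st.Halted prm) {i : Fin n}
    (hi : ¬ prm.c * prm.s ≤ similarity disc cost q (R i)) :
    examine disc cost E prm R q st i =
      { found := st.found
        dissimilar := st.dissimilar + 1
        steps := st.steps + (2 * E.card + 3) } := by
  simp [examine, h, hi]

lemma QueryState.Sound.examine {st : QueryState n} (h : st.Sound disc cost prm R q) (i : Fin n) :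
    (examine disc cost E prm R q st i).Sound disc cost prm R q := by
  classical
  by_cases hh : st.Halted prm
  · rwa [examine_of_halted hh]
  obtain ⟨h1, h2, h3⟩ := h
  have hh' := hh
  simp only [QueryState.Halted, not_or, not_le] at hh'
  by_cases hi : prm.c * prm.s ≤ similarity disc cost q (R i)
  · rw [examine_of_similar hh hi]
    refine ⟨(Finset.card_insert_le _ _).trans hh'.1, fun i' hi' => ?_, h3⟩
    rcases Finset.mem_insert.1 hi' with rfl | hi'
    · exact hi
    · exact h2 i' hi'
  · rw [examine_of_dissimilar hh hi]
    exact ⟨h1, h2, hh'.2⟩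

lemma QueryState.Sound.foldl_examine {st : QueryState n} (h : st.Sound disc cost prm R q)
    (l : List (Fin n)) :
    (l.foldl (Carpool.examine disc cost E prm R q) st).Sound disc cost prm R q := by
  induction l generalizing st with
  | nil => exact h
  | cons a l ih => exact ih (h.examine a)

lemma found_subset_examine (st : QueryState n) (i : Fin n) :
    st.found ⊆ (examine disc cost E prm R q st i).found := by
  classical
  by_cases hh : st.Halted prm
  · rw [examine_of_halted hh]
  by_cases hi : prm.c * prm.s ≤ similarity disc cost q (R i)
  · rw [examine_of_similar hh hi]; exact Finset.subset_insert _ _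
  · rw [examine_of_dissimilar hh hi]

lemma found_subset_foldl_examine (st : QueryState n) (l : List (Fin n)) :
    st.found ⊆ (l.foldl (examine disc cost E prm R q) st).found := by
  induction l generalizing st with
  | nil => exact subset_rfl
  | cons a l ih => exact (found_subset_examine st a).trans (ih _)

/-- Going through a bucket: every step is charged to a dissimilar ride or to one of the distinct
similar rides of the bucket. -/
lemma foldl_examine_steps (l : List (Fin n)) (hl : l.Nodup) (st : QueryState n) :
    ∃ X : Finset (Fin n), X ⊆ (l.foldl (examine disc cost E prm R q) st).found ∧
      (∀ i ∈ X, i ∈ l) ∧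
      (l.foldl (examine disc cost E prm R q) st).steps + (2 * E.card + 3) * st.dissimilar ≤
        st.steps + (2 * E.card + 3) *
          (X.card + (l.foldl (examine disc cost E prm R q) st).dissimilar) := by
  classical
  induction l generalizing st with
  | nil => exact ⟨∅, by simp, by simp, by simp⟩
  | cons a l ih =>
    obtain ⟨hal, hl⟩ := List.nodup_cons.1 hl
    rw [List.foldl_cons]
    by_cases hh : st.Halted prm
    · rw [examine_of_halted hh]
      obtain ⟨X, h1, h2, h3⟩ := ih hl st
      exact ⟨X, h1, fun i hi => List.mem_cons_of_mem _ (h2 i hi), h3⟩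
    obtain ⟨X, h1, h2, h3⟩ := ih hl (examine disc cost E prm R q st a)
    by_cases hi : prm.c * prm.s ≤ similarity disc cost q (R a)
    · have hf := found_subset_foldl_examine (disc := disc) (cost := cost) (E := E) (prm := prm)
        (R := R) (q := q) (examine disc cost E prm R q st a) l
      rw [examine_of_similar hh hi] at h1 h3 hf ⊢
      refine ⟨insert a X, ?_, ?_, ?_⟩
      · exact Finset.insert_subset (hf (Finset.mem_insert_self _ _)) h1
      · intro i hi
        rcases Finset.mem_insert.1 hi with rfl | hi
        · exact List.mem_cons_self
        · exact List.mem_cons_of_mem _ (h2 i hi)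
      · rw [Finset.card_insert_of_notMem fun h => hal (h2 a h)]
        simp only at h3
        linarith
    · rw [examine_of_dissimilar hh hi] at h1 h3 ⊢
      refine ⟨X, h1, fun i hi => List.mem_cons_of_mem _ (h2 i hi), ?_⟩
      simp only at h3
      linarith

/-- Unless `k` rides are found, a bucket with few dissimilar rides is searched completely. -/
lemma foldl_examine_complete [DecidablePred fun i => ¬ prm.c * prm.s ≤ similarity disc cost q (R i)]
    (l : List (Fin n)) (st : QueryState n)
    (hb : st.dissimilar + l.countP (fun i => ¬ prm.c * prm.s ≤ similarity disc cost q (R i)) <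
      prm.budget) :
    prm.k ≤ (l.foldl (examine disc cost E prm R q) st).found.card ∨
      ((∀ i ∈ l, prm.c * prm.s ≤ similarity disc cost q (R i) →
        i ∈ (l.foldl (examine disc cost E prm R q) st).found) ∧
      (l.foldl (examine disc cost E prm R q) st).dissimilar ≤ st.dissimilar +
        l.countP (fun i => ¬ prm.c * prm.s ≤ similarity disc cost q (R i))) := by
  classical
  induction l generalizing st with
  | nil => right; simp
  | cons a l ih =>
    by_cases hk : prm.k ≤ st.found.card
    · left
      rw [foldl_examine_of_halted (Or.inl hk)]; exact hk
    have hh : ¬ st.Halted prm := by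
      rintro (h | h)
      · exact hk h
      · omega
    rw [List.foldl_cons]
    have hf := found_subset_foldl_examine (disc := disc) (cost := cost) (E := E) (prm := prm)
      (R := R) (q := q) (examine disc cost E prm R q st a) l
    by_cases hi : prm.c * prm.s ≤ similarity disc cost q (R a)
    · rw [List.countP_cons_of_neg (by simpa using hi)] at hb ⊢
      rw [examine_of_similar hh hi] at hf ⊢
      rcases ih { found := insert a st.found, dissimilar := st.dissimilar,
                  steps := st.steps + (2 * E.card + 3) } hb with h | ⟨h1, h2⟩
      · exact Or.inl h
      · refine Or.inr ⟨fun i hil hsim => ?_, h2⟩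
        rcases List.mem_cons.1 hil with rfl | hil
        · exact hf (Finset.mem_insert_self _ _)
        · exact h1 i hil hsim
    · rw [List.countP_cons_of_pos (by simpa using hi)] at hb ⊢
      rw [examine_of_dissimilar hh hi]
      rcases ih { found := st.found, dissimilar := st.dissimilar + 1,
                  steps := st.steps + (2 * E.card + 3) } (by simp only; omega) with h | ⟨h1, h2⟩
      · exact Or.inl h
      · refine Or.inr ⟨fun i hil hsim => ?_, by simp only at h2; omega⟩
        rcases List.mem_cons.1 hil with rfl | hil
        · exact absurd hsim hi
        · exact h1 i hil hsim

lemma probeTable_of_halted {ω : Seed E prm} {tables : Fin prm.L → Table E prm.t n}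
    {st : QueryState n} (h : st.Halted prm) (j : Fin prm.L) :
    probeTable disc cost E prm R ω tables q st j = st := by
  simp [probeTable, h]

lemma probeTable_of_not_halted {ω : Seed E prm} {st : QueryState n} (h : ¬ st.Halted prm)
    (j : Fin prm.L) :
    probeTable disc cost E prm R ω (buildIndex disc cost E prm R ω).val q st j =
      (bucket disc cost E prm R ω q j).foldl (examine disc cost E prm R q)
        { found := st.found
          dissimilar := st.dissimilar
          steps := st.steps + hashSteps E prm.t + 1 } := by
  simp only [probeTable, h, if_false]
  rfl

lemma QueryState.Sound.probeTable {ω : Seed E prm} {st : QueryState n}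
    (h : st.Sound disc cost prm R q) (j : Fin prm.L) :
    (probeTable disc cost E prm R ω (buildIndex disc cost E prm R ω).val q st j).Sound
      disc cost prm R q := by
  by_cases hh : st.Halted prm
  · rwa [probeTable_of_halted hh]
  · rw [probeTable_of_not_halted hh]
    exact QueryState.Sound.foldl_examine
      (st := ⟨st.found, st.dissimilar, st.steps + hashSteps E prm.t + 1⟩) h _

lemma probeTable_steps {ω : Seed E prm} {st : QueryState n}
    (h : st.Sound disc cost prm R q) (j : Fin prm.L) :
    (probeTable disc cost E prm R ω (buildIndex disc cost E prm R ω).val q st j).steps +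
        (2 * E.card + 3) * st.dissimilar ≤
      st.steps + (2 * E.card + 3) *
        (probeTable disc cost E prm R ω (buildIndex disc cost E prm R ω).val q st j).dissimilar +
        (hashSteps E prm.t + 1 + (2 * E.card + 3) * prm.k) := by
  have hs := h.probeTable (ω := ω) (E := E) j
  by_cases hh : st.Halted prm
  · rw [probeTable_of_halted hh]; omega
  rw [probeTable_of_not_halted hh] at hs ⊢
  obtain ⟨X, h1, -, h3⟩ := foldl_examine_steps (disc := disc) (cost := cost) (E := E) (prm := prm)
    (R := R) (q := q) (bucket disc cost E prm R ω q j) (nodup_bucket ω j)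
    { found := st.found
      dissimilar := st.dissimilar
      steps := st.steps + hashSteps E prm.t + 1 }
  have h4 := Nat.mul_le_mul_left (2 * E.card + 3) ((Finset.card_le_card h1).trans hs.1)
  simp only [mul_add] at h3 ⊢
  simp only [add_mul] at h3 h4 ⊢
  linarith

lemma sound_foldl_probeTable {ω : Seed E prm} (l : List (Fin prm.L)) {st : QueryState n}
    (h : st.Sound disc cost prm R q) :
    (l.foldl (probeTable disc cost E prm R ω (buildIndex disc cost E prm R ω).val q) st).Sound
      disc cost prm R q := by
  induction l generalizing st with
  | nil => exact h
  | cons a l ih => exact ih (h.probeTable a)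

lemma foldl_probeTable_steps {ω : Seed E prm} (l : List (Fin prm.L)) {st : QueryState n}
    (h : st.Sound disc cost prm R q) :
    (l.foldl (probeTable disc cost E prm R ω (buildIndex disc cost E prm R ω).val q) st).steps +
        (2 * E.card + 3) * st.dissimilar ≤
      st.steps + (2 * E.card + 3) * (l.foldl
        (probeTable disc cost E prm R ω (buildIndex disc cost E prm R ω).val q) st).dissimilar +
        l.length * (hashSteps E prm.t + 1 + (2 * E.card + 3) * prm.k) := by
  induction l generalizing st with
  | nil => simp
  | cons a l ih =>
    rw [List.foldl_cons, List.length_cons, add_one_mul]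
    have h1 := ih (h.probeTable (ω := ω) (E := E) a)
    have h2 := probeTable_steps (ω := ω) (E := E) h a
    linarith

lemma sound_init (m : ℕ) :
    QueryState.Sound disc cost prm R q { found := ∅, dissimilar := 0, steps := m } :=
  ⟨by simp, by simp, by simp⟩

lemma sound_runQuery (ω : Seed E prm) :
    (runQuery disc cost E prm R ω q).Sound disc cost prm R q :=
  sound_foldl_probeTable _ (sound_init _)

/-- The cost of a query, whatever the random choices are. -/
lemma runQuery_steps_le (ω : Seed E prm) :
    (runQuery disc cost E prm R ω q).steps ≤ 4 * E.card + 4 +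
      (2 * E.card + 3) * prm.budget +
      prm.L * (hashSteps E prm.t + 1 + (2 * E.card + 3) * prm.k) := by
  have h := foldl_probeTable_steps (ω := ω) (disc := disc) (cost := cost) (E := E) (prm := prm)
    (R := R) (q := q) (List.finRange prm.L) (sound_init (queryPoint disc E q).steps)
  have h2 := Nat.mul_le_mul_left (2 * E.card + 3)
    (sound_runQuery (disc := disc) (cost := cost) (R := R) (q := q) ω).2.2
  rw [List.length_finRange] at h
  change (runQuery disc cost E prm R ω q).steps + (2 * E.card + 3) * 0 ≤ 4 * E.card + 4 +
    (2 * E.card + 3) * (runQuery disc cost E prm R ω q).dissimilar + _ at h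
  omega

/-- A sufficient condition for a query to succeed: every ride of `T` is met in some table, and
until all of them have been met the buckets contain few dissimilar rides. -/
lemma runQuery_correct
    [DecidablePred fun i => ¬ prm.c * prm.s ≤ similarity disc cost q (R i)]
    {ω : Seed E prm} {T : Finset (Fin n)} (hT : T.card = prm.k)
    (hsim : ∀ i ∈ T, prm.c * prm.s ≤ similarity disc cost q (R i))
    (hmet : ∀ i ∈ T, ∃ j, i ∈ bucket disc cost E prm R ω q j) {C : ℕ}
    (hC : prm.L * C < prm.budget)
    (hrace : ∀ j, (∃ i ∈ T, ∀ j' < j, i ∉ bucket disc cost E prm R ω q j') →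
      (bucket disc cost E prm R ω q j).countP
        (fun i => ¬ prm.c * prm.s ≤ similarity disc cost q (R i)) ≤ C) :
    (runQuery disc cost E prm R ω q).found.card = prm.k ∧
      ∀ i ∈ (runQuery disc cost E prm R ω q).found,
        prm.c * prm.s ≤ similarity disc cost q (R i) := by
  classical
  have hs := sound_runQuery (disc := disc) (cost := cost) (R := R) (q := q) ω
  refine ⟨le_antisymm hs.1 ?_, hs.2.1⟩
  set init : QueryState n :=
    { found := ∅, dissimilar := 0, steps := (queryPoint disc E q).steps } with hinit
  -- the state after `m` tables
  have key : ∀ m, m ≤ prm.L →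
      prm.k ≤ (((List.finRange prm.L).take m).foldl (probeTable disc cost E prm R ω
        (buildIndex disc cost E prm R ω).val q) init).found.card ∨
      ((∀ i ∈ T, (∃ j : Fin prm.L, (j : ℕ) < m ∧ i ∈ bucket disc cost E prm R ω q j) →
        i ∈ (((List.finRange prm.L).take m).foldl (probeTable disc cost E prm R ω
          (buildIndex disc cost E prm R ω).val q) init).found) ∧
      (((List.finRange prm.L).take m).foldl (probeTable disc cost E prm R ω
          (buildIndex disc cost E prm R ω).val q) init).dissimilar ≤ m * C) := by
    intro m
    induction m with
    | zero => intro _; right; simp [hinit]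
    | succ m ih =>
      intro hm
      have htake : (List.finRange prm.L).take (m + 1) =
          (List.finRange prm.L).take m ++ [(⟨m, hm⟩ : Fin prm.L)] := by
        rw [List.take_succ_eq_append_getElem (by simpa using hm)]; simp
      rw [htake, List.foldl_append, List.foldl_cons, List.foldl_nil]
      generalize ((List.finRange prm.L).take m).foldl (probeTable disc cost E prm R ω
        (buildIndex disc cost E prm R ω).val q) init = st at ih ⊢
      by_cases hk : prm.k ≤ st.found.card
      · left
        rw [probeTable_of_halted (Or.inl hk)]; exact hk
      obtain ⟨h1, h2⟩ := (ih (by omega)).resolve_left hk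
      have hmC : (m + 1) * C ≤ prm.L * C := Nat.mul_le_mul_right C hm
      rw [Nat.succ_mul] at hmC ⊢
      have hh : ¬ st.Halted prm := by
        rintro (h | h)
        · exact hk h
        · omega
      -- as `T` has `k` elements, some of them has not been met yet
      have hex : ∃ i ∈ T, ∀ j' < (⟨m, hm⟩ : Fin prm.L), i ∉ bucket disc cost E prm R ω q j' := by
        by_contra! hall
        refine hk (hT ▸ Finset.card_le_card fun i hi => ?_)
        obtain ⟨j', hj', hij'⟩ := hall i hi
        exact h1 i hi ⟨j', hj', hij'⟩
      have hcount := hrace ⟨m, hm⟩ hex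
      rw [probeTable_of_not_halted hh]
      rcases foldl_examine_complete (disc := disc) (cost := cost) (E := E) (prm := prm)
        (R := R) (q := q) (bucket disc cost E prm R ω q ⟨m, hm⟩)
        { found := st.found
          dissimilar := st.dissimilar
          steps := st.steps + hashSteps E prm.t + 1 } (by simp only; omega) with h | ⟨h3, h4⟩
      · exact Or.inl h
      · refine Or.inr ⟨fun i hi ⟨j, hj, hij⟩ => ?_, by simp only at h4; omega⟩
        rcases Nat.lt_succ_iff_lt_or_eq.1 hj with hj | hj
        · exact found_subset_foldl_examine _ _ (h1 i hi ⟨j, hj, hij⟩)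
        · obtain rfl : j = ⟨m, hm⟩ := Fin.ext hj
          exact h3 i hij (hsim i hi)
  have hlast := key prm.L le_rfl
  rw [List.take_of_length_le (by simp)] at hlast
  change prm.k ≤ (runQuery disc cost E prm R ω q).found.card
  rcases hlast with h | ⟨h, -⟩
  · exact h
  · rw [← hT]
    refine Finset.card_le_card fun i hi => ?_
    obtain ⟨j, hj⟩ := hmet i hi
    exact h i hi ⟨j, j.2, hj⟩

lemma indexWords_le (ω : Seed E prm) :
    indexWords disc cost E prm R ω ≤ prm.L * (2 * n) + prm.L * prm.t * (E.card + 2) ^ 2 +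
      n * (E.card + 2) := by
  unfold indexWords
  have h : ∑ j, tableWords E ((buildIndex disc cost E prm R ω).val j) ≤ prm.L * (2 * n) := by
    refine (Finset.sum_le_card_nsmul _ _ (2 * n) fun j _ => ?_).trans (by simp)
    exact tableWords_buildTable_le _ _
  omega

lemma buildIndex_steps (ω : Seed E prm) :
    (buildIndex disc cost E prm R ω).steps =
      n * (4 * E.card + 4) + prm.L * (n * (hashSteps E prm.t + 1)) := by
  simp [buildIndex, buildTable_steps, prepPoint]

end Algorithm

/-! ### Hits and races in independent tables -/

section Race

variable {X : Type*} [MeasurableSpace X] (ν : Measure X) [IsProbabilityMeasure ν] (L : ℕ)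

lemma real_forall_notMem {N : Set X} (hN : MeasurableSet N) :
    (Measure.pi fun _ : Fin L => ν).real {ω | ∀ j, ω j ∉ N} = (1 - ν.real N) ^ L := by
  have h : {ω : Fin L → X | ∀ j, ω j ∉ N} = Set.univ.pi fun _ => Nᶜ := by ext; simp
  rw [h, measureReal_def, Measure.pi_pi, ENNReal.toReal_prod]
  simp only [← measureReal_def, probReal_compl_eq_one_sub hN]
  simp

/-- The probability that, in a sequence of independent trials, `F` occurs before `N` has. -/
lemma real_race_le {N F : Set X} (hN : MeasurableSet N) (hpos : 0 < ν.real N) :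
    (Measure.pi fun _ : Fin L => ν).real {ω | ∃ j, ω j ∈ F ∧ ∀ j' < j, ω j' ∉ N} ≤
      ν.real F / ν.real N := by
  classical
  set a := ν.real N with ha
  have ha1 : a ≤ 1 := measureReal_le_one
  have hj : ∀ j : Fin L, (Measure.pi fun _ : Fin L => ν).real
      {ω | ω j ∈ F ∧ ∀ j' < j, ω j' ∉ N} = ν.real F * (1 - a) ^ (j : ℕ) := by
    intro j
    have h : {ω : Fin L → X | ω j ∈ F ∧ ∀ j' < j, ω j' ∉ N} =
        Set.univ.pi fun j' => if j' < j then Nᶜ else if j' = j then F else Set.univ := by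
      ext ω
      simp only [Set.mem_ofPred_eq, Set.mem_pi, Set.mem_univ, true_implies]
      constructor
      · rintro ⟨h1, h2⟩ j'
        split_ifs with h3 h4
        · exact h2 j' h3
        · exact h4 ▸ h1
        · trivial
      · intro h
        refine ⟨by simpa using h j, fun j' hj' => ?_⟩
        have := h j'
        rw [if_pos hj'] at this
        exact this
    rw [h, measureReal_def, Measure.pi_pi, ENNReal.toReal_prod]
    have h2 : ∀ j' : Fin L,
        (ν (if j' < j then Nᶜ else if j' = j then F else Set.univ)).toReal =
          (if j' < j then (1 - a) else 1) * (if j' = j then ν.real F else 1) := by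
      intro j'
      split_ifs with h3 h4 h4
      · exact absurd (h4 ▸ h3) (lt_irrefl _)
      · rw [mul_one, ← measureReal_def, probReal_compl_eq_one_sub hN]
      · rw [one_mul]; rfl
      · simp
    simp_rw [h2]
    rw [Finset.prod_mul_distrib, Finset.prod_ite_eq', Finset.prod_ite]
    simp [mul_comm, Finset.filter_gt_eq_Iio]
  have hu : {ω : Fin L → X | ∃ j, ω j ∈ F ∧ ∀ j' < j, ω j' ∉ N} =
      ⋃ j ∈ (Finset.univ : Finset (Fin L)), {ω | ω j ∈ F ∧ ∀ j' < j, ω j' ∉ N} := by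
    ext; simp
  rw [hu]
  refine (measureReal_biUnion_finset_le _ _).trans ?_
  simp_rw [hj]
  rw [← Finset.mul_sum, Fin.sum_univ_eq_sum_range (fun j => (1 - a) ^ j), div_eq_mul_inv]
  refine mul_le_mul_of_nonneg_left ?_ measureReal_nonneg
  rw [← one_div, le_div_iff₀ hpos]
  have hg := geom_sum_mul (1 - a) L
  have hp : 0 ≤ (1 - a) ^ L := pow_nonneg (by linarith) L
  nlinarith

end Race

section Failure

variable {Pt : Type u} {Cell : Type v} {disc : Discretization Pt Cell}
  {cost : STEdge Cell → ℝ} {E : Finset (STEdge Cell)} {prm : Params} {n : ℕ}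
  {R : Fin n → Ride Pt} {q : Ride Pt}

/-- The law of the matrices of one table. -/
def tableLaw (E : Finset (STEdge Cell)) (t : ℕ) : Measure (Fin t → Coord E → Coord E → ℝ) :=
  Measure.pi fun _ => gaussianMatrix (Coord E)

instance (t : ℕ) : IsProbabilityMeasure (tableLaw E t) := by
  unfold tableLaw; infer_instance

instance : IsProbabilityMeasure (seedLaw E prm) := by
  unfold seedLaw; infer_instance

/-- The event that a ride lies in the bucket of a query, for one table. -/
def hitEvent (disc : Discretization Pt Cell) (cost : STEdge Cell → ℝ)
    (E : Finset (STEdge Cell)) (prm : Params) (q r : Ride Pt) :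
    Set (Fin prm.t → Coord E → Coord E → ℝ) :=
  {B | ∀ l, B l ∈ collision (prepPoint disc cost E prm r).val (queryPoint disc E q).val}

lemma hitEvent_eq_pi (r : Ride Pt) : hitEvent disc cost E prm q r = Set.univ.pi fun _ =>
    collision (prepPoint disc cost E prm r).val (queryPoint disc E q).val := by
  ext; simp [hitEvent]

lemma measurableSet_hitEvent (r : Ride Pt) : MeasurableSet (hitEvent disc cost E prm q r) := by
  rw [hitEvent_eq_pi]
  exact MeasurableSet.univ_pi fun _ => measurableSet_collision _ _

lemma real_hitEvent (r : Ride Pt) :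
    (tableLaw E prm.t).real (hitEvent disc cost E prm q r) =
      hitProb disc cost E prm q r ^ prm.t := by
  rw [hitEvent_eq_pi, measureReal_def, tableLaw, Measure.pi_pi, ENNReal.toReal_prod]
  simp [hitProb, measureReal_def]

lemma mem_bucket_iff_hitEvent {ω : Seed E prm} {j : Fin prm.L} {i : Fin n} :
    i ∈ bucket disc cost E prm R ω q j ↔ ω j ∈ hitEvent disc cost E prm q (R i) :=
  mem_bucket

lemma hitEvent_congr {r r' : Ride Pt} (h : disc.edges r = disc.edges r') :
    hitEvent disc cost E prm q r = hitEvent disc cost E prm q r' := by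
  have hv : prepVec disc cost E r = prepVec disc cost E r' := by
    unfold prepVec; rw [h]
  simp only [hitEvent, prepPoint, scaledPrep, hv]

lemma hitProb_nonneg {r : Ride Pt} : 0 ≤ hitProb disc cost E prm q r := measureReal_nonneg

lemma hitProb_le_one {r : Ride Pt} : hitProb disc cost E prm q r ≤ 1 := measureReal_le_one

/-- The rides have at most `2 ^ |E|` different sets of edges. -/
lemma exists_representatives {D : ℕ} (hR : ∀ i, disc.edges (R i) ⊆ E) (hD : E.card ≤ D)
    (T : Finset (Fin n)) :
    ∃ T' ⊆ T, T'.card ≤ 2 ^ D ∧ ∀ i ∈ T, ∃ i' ∈ T', disc.edges (R i) = disc.edges (R i') := by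
  classical
  have h : ∀ X : T.image (fun i => disc.edges (R i)), ∃ i ∈ T, disc.edges (R i) = X := fun X =>
    Finset.mem_image.1 X.2
  choose g hg1 hg2 using h
  refine ⟨(Finset.univ.image g), ?_, ?_, ?_⟩
  · intro i hi
    obtain ⟨X, -, rfl⟩ := Finset.mem_image.1 hi
    exact hg1 X
  · refine Finset.card_image_le.trans ?_
    rw [Finset.card_univ, Fintype.card_coe]
    calc (T.image fun i => disc.edges (R i)).card ≤ E.powerset.card := by
          refine Finset.card_le_card fun X hX => ?_
          obtain ⟨i, -, rfl⟩ := Finset.mem_image.1 hX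
          exact Finset.mem_powerset.2 (hR i)
      _ = 2 ^ E.card := Finset.card_powerset E
      _ ≤ 2 ^ D := Nat.pow_le_pow_right (by norm_num) hD
  · intro i hi
    exact ⟨g ⟨_, Finset.mem_image_of_mem _ hi⟩, Finset.mem_image_of_mem _ (Finset.mem_univ _),
      (hg2 ⟨_, Finset.mem_image_of_mem _ hi⟩).symm⟩

/-- The event that a query fails. -/
def failureEvent (disc : Discretization Pt Cell) (cost : STEdge Cell → ℝ)
    (E : Finset (STEdge Cell)) (prm : Params) (R : Fin n → Ride Pt) (q : Ride Pt) :
    Set (Seed E prm) :=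
  {ω | ¬ ((runQuery disc cost E prm R ω q).found.card = prm.k ∧
    ∀ i ∈ (runQuery disc cost E prm R ω q).found,
      prm.c * prm.s ≤ similarity disc cost q (R i))}

/-- The event that a ride is met in no table. -/
def missEvent (disc : Discretization Pt Cell) (cost : STEdge Cell → ℝ)
    (E : Finset (STEdge Cell)) (prm : Params) (q r : Ride Pt) : Set (Seed E prm) :=
  {ω | ∀ j, ω j ∉ hitEvent disc cost E prm q r}

/-- The event that `r'` is met before, or in the same table as, `r` is first met. -/
def raceEvent (disc : Discretization Pt Cell) (cost : STEdge Cell → ℝ)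
    (E : Finset (STEdge Cell)) (prm : Params) (q r r' : Ride Pt) : Set (Seed E prm) :=
  {ω | ∃ j, ω j ∈ hitEvent disc cost E prm q r' ∧
    ∀ j' < j, ω j' ∉ hitEvent disc cost E prm q r}

lemma real_biUnion_missEvent_le {T : Finset (Fin n)} {P : ℝ} (hP0 : 0 ≤ P)
    (hP : ∀ i ∈ T, P ≤ hitProb disc cost E prm q (R i)) :
    (seedLaw E prm).real (⋃ i ∈ T, missEvent disc cost E prm q (R i)) ≤
      T.card * (1 - P ^ prm.t) ^ prm.L := by
  refine (measureReal_biUnion_finset_le _ _).trans ?_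
  rw [← nsmul_eq_mul]
  refine Finset.sum_le_card_nsmul _ _ _ fun i hi => ?_
  have h := real_forall_notMem (tableLaw E prm.t) prm.L
    (measurableSet_hitEvent (disc := disc) (cost := cost) (prm := prm) (q := q) (R i))
  rw [real_hitEvent] at h
  refine (le_of_eq h).trans (pow_le_pow_left₀ ?_ ?_ _)
  · exact sub_nonneg.2 (pow_le_one₀ hitProb_nonneg hitProb_le_one)
  · exact sub_le_sub_left (pow_le_pow_left₀ hP0 (hP i hi) _) _

/-- With a budget that exceeds the number of rides met, a query fails only by missing a similar
ride. -/
lemma real_failureEvent_le_of_lt_budget {T : Finset (Fin n)} (hT : T.card = prm.k)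
    (hsim : ∀ i ∈ T, prm.c * prm.s ≤ similarity disc cost q (R i))
    (hb : prm.L * n < prm.budget) {P : ℝ} (hP0 : 0 ≤ P)
    (hP : ∀ i ∈ T, P ≤ hitProb disc cost E prm q (R i)) :
    (seedLaw E prm).real (failureEvent disc cost E prm R q) ≤
      prm.k * (1 - P ^ prm.t) ^ prm.L := by
  classical
  rw [← hT]
  refine le_trans (measureReal_mono ?_ (measure_ne_top _ _)) (real_biUnion_missEvent_le hP0 hP)
  intro ω hω
  by_contra hno
  simp only [Set.mem_iUnion, missEvent, Set.mem_ofPred_eq, not_exists, not_forall, not_not] at hno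
  refine hω (runQuery_correct hT hsim (fun i hi => ?_) hb fun j _ => ?_)
  · obtain ⟨j, hj⟩ := hno i hi
    exact ⟨j, mem_bucket_iff_hitEvent.2 hj⟩
  · refine List.countP_le_length.trans ?_
    simpa using (nodup_bucket (disc := disc) (cost := cost) (R := R) (q := q) ω j).length_le_card

/-- Otherwise it may also fail when a dissimilar ride is met too early. As the rides have a
bounded number of different sets of edges, only boundedly many races have to be considered. -/
lemma real_failureEvent_le {D : ℕ} (hR : ∀ i, disc.edges (R i) ⊆ E) (hD : E.card ≤ D)
    {T : Finset (Fin n)} (hT : T.card = prm.k)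
    (hsim : ∀ i ∈ T, prm.c * prm.s ≤ similarity disc cost q (R i))
    (hb : 0 < prm.budget) {P : ℝ} (hP0 : 0 < P)
    (hP : ∀ i ∈ T, P ≤ hitProb disc cost E prm q (R i)) {ratio : ℝ} (hratio0 : 0 ≤ ratio)
    (hratio : ∀ i ∈ T, ∀ i', ¬ prm.c * prm.s ≤ similarity disc cost q (R i') →
      hitProb disc cost E prm q (R i') ≤ ratio * hitProb disc cost E prm q (R i)) :
    (seedLaw E prm).real (failureEvent disc cost E prm R q) ≤
      prm.k * (1 - P ^ prm.t) ^ prm.L + 4 ^ D * ratio ^ prm.t := by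
  classical
  obtain ⟨N, hNT, hNcard, hN⟩ := exists_representatives hR hD T
  obtain ⟨F, hFs, hFcard, hF⟩ := exists_representatives hR hD
    (Finset.univ.filter fun i => ¬ prm.c * prm.s ≤ similarity disc cost q (R i))
  have hsub : failureEvent disc cost E prm R q ⊆
      (⋃ i ∈ T, missEvent disc cost E prm q (R i)) ∪
        ⋃ z ∈ N ×ˢ F, raceEvent disc cost E prm q (R z.1) (R z.2) := by
    intro ω hω
    by_contra hno
    rw [Set.mem_union, not_or] at hno
    obtain ⟨hmiss, hrace⟩ := hno
    simp only [Set.mem_iUnion, missEvent, Set.mem_ofPred_eq, not_exists, not_forall, not_not]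
      at hmiss
    refine hω (runQuery_correct (C := 0) hT hsim (fun i hi => ?_) (by simpa using hb) ?_)
    · obtain ⟨j, hj⟩ := hmiss i hi
      exact ⟨j, mem_bucket_iff_hitEvent.2 hj⟩
    · rintro j ⟨i, hi, hfirst⟩
      rw [Nat.le_zero, List.countP_eq_zero]
      intro i' hi' hdis
      obtain ⟨a, ha, hia⟩ := hN i hi
      obtain ⟨b, hbF, hib⟩ := hF i' (by simpa using hdis)
      refine hrace ?_
      simp only [Set.mem_iUnion]
      refine ⟨(a, b), Finset.mem_product.2 ⟨ha, hbF⟩, j, ?_, fun j' hj' => ?_⟩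
      · rw [← hitEvent_congr hib]; exact mem_bucket_iff_hitEvent.1 hi'
      · rw [← hitEvent_congr hia]
        exact fun h => hfirst j' hj' (mem_bucket_iff_hitEvent.2 h)
  refine (measureReal_mono hsub (measure_ne_top _ _)).trans
    ((measureReal_union_le _ _).trans (add_le_add ?_ ?_))
  · rw [← hT]; exact real_biUnion_missEvent_le hP0.le hP
  · refine (measureReal_biUnion_finset_le _ _).trans ?_
    have hone : ∀ z ∈ N ×ˢ F,
        (seedLaw E prm).real (raceEvent disc cost E prm q (R z.1) (R z.2)) ≤ ratio ^ prm.t := by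
      rintro ⟨i, i'⟩ hz
      obtain ⟨hi, hi'⟩ := Finset.mem_product.1 hz
      have hpos : 0 < hitProb disc cost E prm q (R i) := hP0.trans_le (hP i (hNT hi))
      have hle := hratio i (hNT hi) i' (Finset.mem_filter.1 (hFs hi')).2
      have h := real_race_le (tableLaw E prm.t) prm.L
        (F := hitEvent disc cost E prm q (R i'))
        (measurableSet_hitEvent (disc := disc) (cost := cost) (prm := prm) (q := q) (R i))
        (by rw [real_hitEvent]; exact pow_pos hpos _)
      rw [real_hitEvent, real_hitEvent, ← div_pow] at h
      exact h.trans (pow_le_pow_left₀ (div_nonneg hitProb_nonneg hpos.le)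
        ((div_le_iff₀ hpos).2 hle) _)
    refine (Finset.sum_le_card_nsmul _ _ _ hone).trans ?_
    rw [nsmul_eq_mul]
    refine mul_le_mul_of_nonneg_right ?_ (pow_nonneg hratio0 _)
    have : (N ×ˢ F).card ≤ 4 ^ D := by
      rw [Finset.card_product]
      calc N.card * F.card ≤ 2 ^ D * 2 ^ D := Nat.mul_le_mul hNcard hFcard
        _ = 4 ^ D := by rw [← mul_pow]; norm_num
    exact_mod_cast this

end Failure

/-! ### Choice of the parameters -/

section Parameters

variable {P f : ℝ} {n k : ℕ}

lemma log_one_div_sq_half (P : ℝ) : Real.log (1 / (P / 2) ^ 2) = -(2 * Real.log (P / 2)) := by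
  rw [one_div, Real.log_inv, Real.log_pow]; norm_num

lemma log_half_neg (hP0 : 0 < P) (hP1 : P ≤ 1) : Real.log (P / 2) < 0 :=
  Real.log_neg (by linarith) (by linarith)

/-- With `p = (P / 2) ^ 2`, the probability of a hit in one table is at least `n ^ (-1 / 2)`, with
a factor of `2 ^ t` to spare. -/
lemma two_pow_le_pow_mul_sqrt (hP0 : 0 < P) (hP1 : P ≤ 1) (hn : 0 < n) {t : ℕ}
    (ht : (t : ℝ) ≤ Real.log n / Real.log (1 / (P / 2) ^ 2)) :
    2 ^ t ≤ P ^ t * (n : ℝ) ^ (1 / 2 : ℝ) := by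
  have hl := log_half_neg hP0 hP1
  have hn' : (0 : ℝ) < n := by exact_mod_cast hn
  rw [log_one_div_sq_half, le_div_iff₀ (by linarith)] at ht
  have h1 : (1 : ℝ) ≤ (P / 2) ^ t * (n : ℝ) ^ (1 / 2 : ℝ) := by
    rw [← Real.exp_log (show 0 < P / 2 by linarith), ← Real.exp_nat_mul, Real.rpow_def_of_pos hn',
      ← Real.exp_add]
    apply Real.one_le_exp
    linarith
  calc (2 : ℝ) ^ t = 2 ^ t * 1 := (mul_one _).symm
    _ ≤ 2 ^ t * ((P / 2) ^ t * (n : ℝ) ^ (1 / 2 : ℝ)) := by gcongr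
    _ = P ^ t * (n : ℝ) ^ (1 / 2 : ℝ) := by
      rw [← mul_assoc, ← mul_pow]; congr 2; ring

lemma log_div_pos (hf0 : 0 < f) (hf1 : f < 1) (hk : 0 < k) : 0 < Real.log (k / f) := by
  have hk' : (1 : ℝ) ≤ k := by exact_mod_cast hk
  exact Real.log_pos ((one_lt_div hf0).2 (by linarith))

/-- The number of tables is large enough for the similar rides to be missed with probability at
most `f ^ 2`, which leaves `f - f ^ 2` for other failures. -/
lemma mul_one_sub_pow_le (hP0 : 0 < P) (hP1 : P ≤ 1) (hn : 0 < n) (hk : 0 < k) (hf0 : 0 < f)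
    (hf1 : f < 1) {t L : ℕ} (ht : (t : ℝ) ≤ Real.log n / Real.log (1 / (P / 2) ^ 2))
    (hL : (n : ℝ) ^ (1 / 2 : ℝ) * Real.log (k / f) ≤ L) (hL0 : 0 < L) :
    k * (1 - P ^ t) ^ L ≤ f ^ 2 := by
  have hk' : (1 : ℝ) ≤ k := by exact_mod_cast hk
  rcases Nat.eq_zero_or_pos t with rfl | ht0
  · rw [pow_zero, sub_self, zero_pow hL0.ne', mul_zero]; positivity
  have h1 := two_pow_le_pow_mul_sqrt hP0 hP1 hn ht
  have h2 : (2 : ℝ) ≤ 2 ^ t := le_self_pow₀ (by norm_num) ht0.ne'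
  have hlog := log_div_pos hf0 hf1 hk
  have hPt : 0 < P ^ t := pow_pos hP0 t
  have hPt1 : P ^ t ≤ 1 := pow_le_one₀ hP0.le hP1
  have h3 : 2 * Real.log (k / f) ≤ L * P ^ t := by
    calc 2 * Real.log (k / f) ≤ (P ^ t * (n : ℝ) ^ (1 / 2 : ℝ)) * Real.log (k / f) := by
          gcongr; linarith
      _ = (n : ℝ) ^ (1 / 2 : ℝ) * Real.log (k / f) * P ^ t := by ring
      _ ≤ L * P ^ t := by gcongr
  have h4 : (1 - P ^ t) ^ L ≤ (f / k) ^ 2 := by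
    calc (1 - P ^ t) ^ L ≤ Real.exp (-P ^ t) ^ L :=
          pow_le_pow_left₀ (by linarith) (Real.one_sub_le_exp_neg _) L
      _ = Real.exp (-(L * P ^ t)) := by rw [← Real.exp_nat_mul]; ring_nf
      _ ≤ Real.exp (-(2 * Real.log (k / f))) := Real.exp_le_exp.2 (by linarith)
      _ = (f / k) ^ 2 := by
        rw [← mul_neg, ← Real.log_inv, inv_div]
        have : Real.exp ((2 : ℕ) * Real.log (f / k)) = (f / k) ^ 2 := by
          rw [Real.exp_nat_mul, Real.exp_log (by positivity)]
        exact_mod_cast this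
  calc k * (1 - P ^ t) ^ L ≤ k * (f / k) ^ 2 := by gcongr
    _ = f ^ 2 / k := by field_simp
    _ ≤ f ^ 2 := div_le_self (by positivity) hk'

lemma lt_pow_of_floor_lt (hP0 : 0 < P) (hP1 : P ≤ 1) (hn : 0 < n) {m : ℕ}
    (h : ⌊Real.log n / Real.log (1 / (P / 2) ^ 2)⌋₊ < m) : (n : ℝ) < (1 / (P / 2) ^ 2) ^ m := by
  have hl := log_half_neg hP0 hP1
  have hn' : (0 : ℝ) < n := by exact_mod_cast hn
  have h1 := Nat.lt_of_floor_lt h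
  rw [div_lt_iff₀ (by rw [log_one_div_sq_half]; linarith), ← Real.log_pow] at h1
  exact (Real.log_lt_log_iff hn' (by positivity)).1 h1

/-- A constant that compares the number of tables to `n ^ ρ * log (k + 1)`. -/
def tableFactor (f : ℝ) : ℝ := 1 + (Real.log (1 / f) + 1) / Real.log 2

lemma tableFactor_pos (hf0 : 0 < f) (hf1 : f < 1) : 0 < tableFactor f := by
  have h1 : 0 < Real.log 2 := Real.log_pos (by norm_num)
  have h2 : 0 < Real.log (1 / f) := Real.log_pos ((one_lt_div hf0).2 hf1)
  unfold tableFactor; positivity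

lemma ceil_le_tableFactor_mul (hn : 0 < n) (hk : 0 < k) (hf0 : 0 < f) (hf1 : f < 1) :
    (⌈(n : ℝ) ^ (1 / 2 : ℝ) * Real.log (k / f)⌉₊ : ℝ) ≤
      tableFactor f * ((n : ℝ) ^ (1 / 2 : ℝ) * Real.log (k + 1)) := by
  have hk' : (1 : ℝ) ≤ k := by exact_mod_cast hk
  have hn' : (1 : ℝ) ≤ n := by exact_mod_cast hn
  have hlog := log_div_pos hf0 hf1 hk
  have h1 : 0 < Real.log 2 := Real.log_pos (by norm_num)
  have h2 : 0 < Real.log (1 / f) := Real.log_pos ((one_lt_div hf0).2 hf1)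
  have h3 : Real.log 2 ≤ Real.log (k + 1) := Real.log_le_log (by norm_num) (by linarith)
  have h4 : 1 ≤ (n : ℝ) ^ (1 / 2 : ℝ) := Real.one_le_rpow hn' (by norm_num)
  have h5 : Real.log (k / f) ≤ Real.log (k + 1) + Real.log (1 / f) := by
    rw [div_eq_mul_one_div, Real.log_mul (by positivity) (by positivity)]
    have := Real.log_le_log (by linarith) (show (k : ℝ) ≤ k + 1 by linarith)
    linarith
  have h6 := Nat.ceil_lt_add_one (show 0 ≤ (n : ℝ) ^ (1 / 2 : ℝ) * Real.log (k / f) by positivity)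
  have h7 : 1 ≤ Real.log (k + 1) / Real.log 2 := (one_le_div h1).2 h3
  have h8 : Real.log (k / f) + 1 ≤ tableFactor f * Real.log (k + 1) := by
    have : tableFactor f * Real.log (k + 1) = Real.log (k + 1) +
        (Real.log (1 / f) + 1) * (Real.log (k + 1) / Real.log 2) := by
      unfold tableFactor; ring
    nlinarith
  nlinarith

lemma log_natCast_le_self (hn : 0 < n) : Real.log n ≤ n := by
  have hn' : (0 : ℝ) < n := by exact_mod_cast hn
  have := Real.log_le_sub_one_of_pos hn'
  linarith

end Parameters

section Growth

variable {Pt : Type u} {Cell : Type v} {disc : Discretization Pt Cell}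
  {cost : STEdge Cell → ℝ} {E : Finset (STEdge Cell)} {prm : Params} {n : ℕ}
  {R : Fin n → Ride Pt} {q : Ride Pt}

/-- A bound for the steps per hash function, for at most `D` edges. -/
def hashCost (D : ℕ) : ℕ := 2 * (D + 2) ^ 2 + 2 * (D + 2) + 1

lemma hashSteps_le {D : ℕ} (hD : E.card ≤ D) (t : ℕ) : hashSteps E t ≤ t * hashCost D := by
  unfold hashSteps hashCost
  rw [mul_add _ _ 1, mul_one]
  gcongr

variable {D b : ℕ} {τ ell : ℝ}

lemma runQuery_steps_le_mul (hD : E.card ≤ D) (hb : prm.budget = b * prm.L) (hL : 0 < prm.L)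
    (hk : 0 < prm.k) (hτ : 0 ≤ τ) (hell : 0 ≤ ell) (ht : (prm.t : ℝ) ≤ τ * ell)
    (ω : Seed E prm) :
    ((runQuery disc cost E prm R ω q).steps : ℝ) ≤
      (4 * D + 4 + (2 * D + 3) * b + τ * hashCost D + 1 + (2 * D + 3)) *
        (prm.L * (prm.k + ell)) := by
  have h1 : (runQuery disc cost E prm R ω q).steps ≤ 4 * D + 4 + (2 * D + 3) * (b * prm.L) +
      prm.L * (prm.t * hashCost D + 1 + (2 * D + 3) * prm.k) := by
    rw [← hb]
    refine (runQuery_steps_le ω).trans ?_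
    have := hashSteps_le hD prm.t
    gcongr
  have h2 : ((runQuery disc cost E prm R ω q).steps : ℝ) ≤ 4 * D + 4 +
      (2 * D + 3) * (b * prm.L) +
      prm.L * (prm.t * hashCost D + 1 + (2 * D + 3) * prm.k) := by exact_mod_cast h1
  have hL' : (1 : ℝ) ≤ prm.L := by exact_mod_cast hL
  have hk' : (1 : ℝ) ≤ prm.k := by exact_mod_cast hk
  have hu : 1 ≤ prm.k + ell := by linarith
  have hLu : 1 ≤ prm.L * (prm.k + ell) := one_le_mul_of_one_le_of_one_le hL' hu
  calc ((runQuery disc cost E prm R ω q).steps : ℝ)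
      ≤ (4 * D + 4) * 1 + (2 * D + 3) * b * (prm.L * 1) +
        (hashCost D * (prm.L * prm.t) + prm.L * 1 + (2 * D + 3) * (prm.L * prm.k)) := by
        refine h2.trans (le_of_eq ?_); ring
    _ ≤ (4 * D + 4) * (prm.L * (prm.k + ell)) + (2 * D + 3) * b * (prm.L * (prm.k + ell)) +
        (hashCost D * (prm.L * (τ * (prm.k + ell))) + prm.L * (prm.k + ell) +
          (2 * D + 3) * (prm.L * (prm.k + ell))) := by
        have h3 : (prm.t : ℝ) ≤ τ * (prm.k + ell) :=
          ht.trans (mul_le_mul_of_nonneg_left (by linarith) hτ)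
        have h4 : (prm.k : ℝ) ≤ prm.k + ell := by linarith
        gcongr
    _ = _ := by ring

lemma indexWords_le_mul (hD : E.card ≤ D) (hL : 0 < prm.L) (hτ : 0 ≤ τ)
    (hn : ell ≤ n) (ht : (prm.t : ℝ) ≤ τ * ell) (ω : Seed E prm) :
    (indexWords disc cost E prm R ω : ℝ) ≤
      (2 + τ * (D + 2) ^ 2 + (D + 2)) * (prm.L * n) := by
  have h1 : indexWords disc cost E prm R ω ≤ prm.L * (2 * n) + prm.L * prm.t * (D + 2) ^ 2 +
      n * (D + 2) := by
    refine (indexWords_le ω).trans ?_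
    gcongr
  have h2 : (indexWords disc cost E prm R ω : ℝ) ≤ prm.L * (2 * n) +
      prm.L * prm.t * (D + 2) ^ 2 + n * (D + 2) := by exact_mod_cast h1
  have hL' : (1 : ℝ) ≤ prm.L := by exact_mod_cast hL
  have h3 : (prm.t : ℝ) ≤ τ * n := ht.trans (mul_le_mul_of_nonneg_left hn hτ)
  calc (indexWords disc cost E prm R ω : ℝ)
      ≤ prm.L * (2 * n) + prm.L * prm.t * (D + 2) ^ 2 + 1 * n * (D + 2) := by rwa [one_mul]
    _ ≤ prm.L * (2 * n) + prm.L * (τ * n) * (D + 2) ^ 2 + prm.L * n * (D + 2) := by gcongr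
    _ = _ := by ring

lemma totalSteps_le_mul (hD : E.card ≤ D) (hb : prm.budget = b * prm.L) (hL : 0 < prm.L)
    (hk : 0 < prm.k) (hτ : 0 ≤ τ) (hell : 0 ≤ ell) (ht : (prm.t : ℝ) ≤ τ * ell)
    (ω : Seed E prm) :
    (totalSteps disc cost E prm R ω : ℝ) ≤
      ((4 * D + 4 + τ * hashCost D + 1) +
        (4 * D + 4 + (2 * D + 3) * b + τ * hashCost D + 1 + (2 * D + 3))) *
        (n * (prm.L * (prm.k + ell))) := by
  have hq : (∑ i, ((runQuery disc cost E prm R ω (R i)).steps : ℝ)) ≤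
      n * ((4 * D + 4 + (2 * D + 3) * b + τ * hashCost D + 1 + (2 * D + 3)) *
        (prm.L * (prm.k + ell))) := by
    refine (Finset.sum_le_card_nsmul _ _ _ fun i _ =>
      runQuery_steps_le_mul hD hb hL hk hτ hell ht ω).trans (le_of_eq ?_)
    simp
  have h1 : (buildIndex disc cost E prm R ω).steps ≤
      n * (4 * D + 4) + prm.L * (n * (prm.t * hashCost D + 1)) := by
    rw [buildIndex_steps]
    have := hashSteps_le hD prm.t
    gcongr
  have h2 : ((buildIndex disc cost E prm R ω).steps : ℝ) ≤
      n * (4 * D + 4) + prm.L * (n * (prm.t * hashCost D + 1)) := by exact_mod_cast h1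
  have hL' : (1 : ℝ) ≤ prm.L := by exact_mod_cast hL
  have hk' : (1 : ℝ) ≤ prm.k := by exact_mod_cast hk
  have hu : 1 ≤ prm.k + ell := by linarith
  have hLu : 1 ≤ prm.L * (prm.k + ell) := one_le_mul_of_one_le_of_one_le hL' hu
  have h3 : (prm.t : ℝ) ≤ τ * (prm.k + ell) :=
    ht.trans (mul_le_mul_of_nonneg_left (by linarith) hτ)
  have h4 : ((buildIndex disc cost E prm R ω).steps : ℝ) ≤
      (4 * D + 4 + τ * hashCost D + 1) * (n * (prm.L * (prm.k + ell))) := by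
    calc ((buildIndex disc cost E prm R ω).steps : ℝ)
        ≤ n * ((4 * D + 4) * 1) + n * (hashCost D * (prm.L * prm.t) + prm.L * 1) := by
          refine h2.trans (le_of_eq ?_); ring
      _ ≤ n * ((4 * D + 4) * (prm.L * (prm.k + ell))) +
          n * (hashCost D * (prm.L * (τ * (prm.k + ell))) + prm.L * (prm.k + ell)) := by gcongr
      _ = _ := by ring
  rw [totalSteps]
  push_cast
  refine (add_le_add h4 hq).trans (le_of_eq ?_)
  ring

end Growth

/-! ### The failure probability for the chosen parameters -/

section Main

variable {Pt : Type u} {Cell : Type v} {disc : Discretization Pt Cell}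
  {cost : STEdge Cell → ℝ} {E : Finset (STEdge Cell)} {prm : Params} {n : ℕ}
  {R : Fin n → Ride Pt} {q : Ride Pt}

/-- A scale for which the preprocessing vectors are so short that the last coordinates of `P`
hardly affect the angles. -/
def ridesScale (D : ℕ) (W c : ℝ) : ℝ := (1 - c) / (4 * (D * W ^ 2 + 1))

lemma ridesScale_pos {D : ℕ} {W c : ℝ} (hc1 : c < 1) : 0 < ridesScale D W c :=
  div_pos (by linarith) (by positivity)

lemma sq_ridesScale_mul_le {D : ℕ} {W c : ℝ} (hc0 : 0 < c) (hc1 : c < 1) :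
    ridesScale D W c ^ 2 * (D * W ^ 2) ≤ (1 - c) / 4 := by
  have hY : (0 : ℝ) ≤ D * W ^ 2 := by positivity
  have h0 := ridesScale_pos (D := D) (W := W) hc1
  have h1 : ridesScale D W c * (D * W ^ 2 + 1) = (1 - c) / 4 := by
    unfold ridesScale; field_simp
  have h2 : ridesScale D W c ≤ 1 := by nlinarith
  nlinarith [mul_nonneg h0.le hY]

/-- A lower bound for `cosUnit`, for at most `D` edges. -/
def minCosUnit (D : ℕ) (scale s : ℝ) : ℝ := scale * s / (√2 * √(D : ℝ))

/-- A lower bound for the hash collision probabilities of similar rides. -/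
def nearProb (D : ℕ) (scale s : ℝ) : ℝ := min 1 (hashSlope (D + 2) * minCosUnit D scale s)

/-- An upper bound for the ratio of the hash collision probabilities of dissimilar and similar
rides. -/
def farRatio (D : ℕ) (scale c s : ℝ) : ℝ :=
  max 0 (1 - hashSlope (D + 2) * ((1 - c) * minCosUnit D scale s))

lemma hashSlope_pos {d : ℕ} (hd : 0 < d) : 0 < hashSlope d := by
  have := gaussianAbsMoment_pos
  have hd' : (0 : ℝ) < d := by exact_mod_cast hd
  unfold hashSlope; positivity

lemma minCosUnit_pos {D : ℕ} {scale s : ℝ} (hD : 0 < D) (hscale : 0 < scale) (hs : 0 < s) :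
    0 < minCosUnit D scale s := by
  have hD' : (0 : ℝ) < D := by exact_mod_cast hD
  unfold minCosUnit; positivity

lemma nearProb_pos {D : ℕ} {scale s : ℝ} (hD : 0 < D) (hscale : 0 < scale) (hs : 0 < s) :
    0 < nearProb D scale s :=
  lt_min one_pos (mul_pos (hashSlope_pos (by omega)) (minCosUnit_pos hD hscale hs))

lemma nearProb_le_one {D : ℕ} {scale s : ℝ} : nearProb D scale s ≤ 1 := min_le_left _ _

lemma farRatio_lt_one {D : ℕ} {scale c s : ℝ} (hc1 : c < 1) (hD : 0 < D) (hscale : 0 < scale)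
    (hs : 0 < s) : farRatio D scale c s < 1 := by
  have := mul_pos (hashSlope_pos (show 0 < D + 2 by omega))
    (mul_pos (sub_pos.2 hc1) (minCosUnit_pos hD hscale hs))
  exact max_lt one_pos (by linarith)

/-- The failure probability of a query. If the keys are long, then the similar rides win the race
against the dissimilar ones; if they are short, then there are fewer rides than the budget
allows. -/
lemma real_failureEvent_le_of_params {D : ℕ} {W f : ℝ} {k m b : ℕ} (hn : 0 < n) (hk : 0 < k)
    (hc0 : 0 < prm.c) (hc1 : prm.c < 1) (hs : 0 < prm.s) (hscale : 0 < prm.scale)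
    (hf0 : 0 < f) (hf1 : f < 1)
    (hD0 : 0 < D) (hD : E.card ≤ D) (hcost : ∀ e ∈ E, 0 ≤ cost e ∧ cost e ≤ W)
    (hR : ∀ i, disc.edges (R i) ⊆ E) (hq : disc.edges q ⊆ E)
    (hnorm : ∀ i, ‖scaledPrep disc cost E prm (R i)‖ ^ 2 ≤ (1 - prm.c) / 4)
    (hpk : prm.k = k)
    (hpt : prm.t = ⌊Real.log n / Real.log (1 / (nearProb D prm.scale prm.s / 2) ^ 2)⌋₊)
    (hpL : (n : ℝ) ^ (1 / 2 : ℝ) * Real.log (k / f) ≤ prm.L) (hL : 0 < prm.L)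
    (hpb : prm.budget = b * prm.L)
    (hm : 4 ^ D * farRatio D prm.scale prm.c prm.s ^ m < f - f ^ 2)
    (hb : (1 / (nearProb D prm.scale prm.s / 2) ^ 2) ^ m < (b : ℝ))
    {T : Finset (Fin n)} (hT : T.card = k) (hsim : ∀ i ∈ T, prm.s ≤ similarity disc cost q (R i)) :
    (seedLaw E prm).real (failureEvent disc cost E prm R q) ≤ f := by
  set P := nearProb D prm.scale prm.s with hPdef
  have hP0 : 0 < P := nearProb_pos hD0 hscale hs
  have hP1 : P ≤ 1 := nearProb_le_one
  have hratio0 : 0 ≤ farRatio D prm.scale prm.c prm.s := le_max_left _ _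
  have hsim' : ∀ i ∈ T, prm.c * prm.s ≤ similarity disc cost q (R i) := fun i hi =>
    le_trans (by nlinarith) (hsim i hi)
  have hP : ∀ i ∈ T, P ≤ hitProb disc cost E prm q (R i) := fun i hi =>
    (min_le_right _ _).trans
      (le_hitProb_of_similar hc0 hc1 hs hscale hq hD (hnorm i) (hsim i hi))
  have hlog : 0 < Real.log (1 / (P / 2) ^ 2) := by
    rw [log_one_div_sq_half]
    have := log_half_neg hP0 hP1
    linarith
  have hlogn : 0 ≤ Real.log n := Real.log_natCast_nonneg n
  have ht : (prm.t : ℝ) ≤ Real.log n / Real.log (1 / (P / 2) ^ 2) := by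
    rw [hpt]; exact Nat.floor_le (by positivity)
  have hmiss := mul_one_sub_pow_le hP0 hP1 hn hk hf0 hf1 ht hpL hL
  have hbpos : 0 < b := by
    have : (0 : ℝ) < b := lt_trans (by positivity) hb
    exact_mod_cast this
  rcases lt_or_ge prm.t m with hlt | hge
  · rw [hpt] at hlt
    have hnb : n < b := by exact_mod_cast (lt_pow_of_floor_lt hP0 hP1 hn hlt).trans hb
    have h := real_failureEvent_le_of_lt_budget (hT.trans hpk.symm) hsim'
      (by rw [hpb, mul_comm]; exact Nat.mul_lt_mul_of_pos_right hnb hL) hP0.le hP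
    rw [hpk] at h
    nlinarith
  · have h := real_failureEvent_le hR hD (hT.trans hpk.symm) hsim'
      (by rw [hpb]; exact Nat.mul_pos hbpos hL) hP0 hP hratio0 (fun i hi i' hi' => by
        have h1 := hitProb_gap hc0 hc1 hs hscale hq hD hcost (hnorm i) (hsim i hi) (not_le.1 hi')
        have h2 : hitProb disc cost E prm q (R i) ≤ 1 := hitProb_le_one
        have h3 : 0 ≤ hitProb disc cost E prm q (R i) := hitProb_nonneg
        have h4 := mul_pos (hashSlope_pos (show 0 < D + 2 by omega))
          (mul_pos (sub_pos.2 hc1) (minCosUnit_pos hD0 hscale hs))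
        have h5 := mul_le_mul_of_nonneg_right (le_max_right 0
          (1 - hashSlope (D + 2) * ((1 - prm.c) * minCosUnit D prm.scale prm.s))) h3
        refine le_trans ?_ h5
        refine h1.trans ?_
        rw [← minCosUnit]
        nlinarith)
    rw [hpk] at h
    have hpow : farRatio D prm.scale prm.c prm.s ^ prm.t ≤ farRatio D prm.scale prm.c prm.s ^ m :=
      pow_le_pow_of_le_one hratio0 (farRatio_lt_one hc1 hD0 hscale hs).le hge
    have : (4 : ℝ) ^ D * farRatio D prm.scale prm.c prm.s ^ prm.t ≤
        4 ^ D * farRatio D prm.scale prm.c prm.s ^ m := by gcongr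
    linarith

end Main

end Carpool

end

theorem mainTheorem1 {Pt : Type*} {Cell : Type*} (D : ℕ) (W c s : ℝ)
    (hc0 : 0 < c) (hc1 : c < 1) (hs : 0 < s) :
    ∃ ρ p scale : ℝ, 0 < ρ ∧ ρ < 1 ∧ 0 < p ∧ p < 1 ∧ 0 < scale ∧
      ∀ f : ℝ, 0 < f → f < 1 →
      ∃ (b : ℕ) (K : ℝ), 0 < K ∧
      ∀ (disc : Carpool.Discretization Pt Cell) (cost : Carpool.STEdge Cell → ℝ)
        (E : Finset (Carpool.STEdge Cell)),
        E.card ≤ D → (∀ e ∈ E, 0 ≤ cost e ∧ cost e ≤ W) →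
      ∀ (n k : ℕ), 0 < n → 0 < k →
      ∀ R : Fin n → Carpool.Ride Pt, (∀ i, disc.edges (R i) ⊆ E) →
        (∀ i, ‖Carpool.scaledPrep disc cost E
            (Carpool.params c s scale p ρ f b k n) (R i)‖ ≤ 3 / 4) ∧
        Carpool.SolvesOMS (Carpool.seedLaw E (Carpool.params c s scale p ρ f b k n))
          disc cost R {q | disc.edges q ⊆ E}
          (fun ω q =>
            (Carpool.runQuery disc cost E (Carpool.params c s scale p ρ f b k n) R ω q).found)
          c s k f ∧
        (∀ (ω : Carpool.Seed E (Carpool.params c s scale p ρ f b k n)) (q : Carpool.Ride Pt),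
          disc.edges q ⊆ E →
          ((Carpool.runQuery disc cost E
              (Carpool.params c s scale p ρ f b k n) R ω q).steps : ℝ) ≤
            K * ((n : ℝ) ^ ρ * (k + Real.log n) * Real.log (k + 1))) ∧
        (∀ ω : Carpool.Seed E (Carpool.params c s scale p ρ f b k n),
          (Carpool.indexWords disc cost E
              (Carpool.params c s scale p ρ f b k n) R ω : ℝ) ≤
            K * ((n : ℝ) ^ (1 + ρ) * Real.log (k + 1))) ∧
        (∀ ω : Carpool.Seed E (Carpool.params c s scale p ρ f b k n),
          (Carpool.totalSteps disc cost E
              (Carpool.params c s scale p ρ f b k n) R ω : ℝ) ≤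
            K * ((n : ℝ) ^ (1 + ρ) * (k + Real.log n) * Real.log (k + 1))) := by
  set scale := Carpool.ridesScale (D + 1) W c with hscale
  set P := Carpool.nearProb (D + 1) scale s with hP
  have hscale0 : 0 < scale := Carpool.ridesScale_pos hc1
  -- one more edge than allowed keeps the bounds from degenerating when `D = 0`
  have hP0 : 0 < P := Carpool.nearProb_pos (Nat.succ_pos D) hscale0 hs
  have hP1 : P ≤ 1 := Carpool.nearProb_le_one
  refine ⟨1 / 2, (P / 2) ^ 2, scale, by norm_num, by norm_num, by positivity,
    by nlinarith, hscale0, fun f hf0 hf1 => ?_⟩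
  -- keys of length at least `m` make all races safe; shorter keys occur only for `n < b`
  obtain ⟨m, hm⟩ := exists_pow_lt_of_lt_one
    (show 0 < (f - f ^ 2) / 4 ^ (D + 1) from div_pos (by nlinarith) (by positivity))
    (Carpool.farRatio_lt_one hc1 (Nat.succ_pos D) hscale0 hs)
  obtain ⟨b, hb⟩ := exists_nat_gt ((1 / (P / 2) ^ 2) ^ m)
  set τ := 1 / Real.log (1 / (P / 2) ^ 2) with hτ
  have hlog : 0 < Real.log (1 / (P / 2) ^ 2) := by
    rw [Carpool.log_one_div_sq_half]
    have := Carpool.log_half_neg hP0 hP1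
    linarith
  have hτ0 : 0 < τ := one_div_pos.2 hlog
  have hM0 := Carpool.tableFactor_pos hf0 hf1
  set K₁ : ℝ := 4 * D + 4 + (2 * D + 3) * b + τ * Carpool.hashCost D + 1 + (2 * D + 3) with hK₁
  set K₂ : ℝ := 2 + τ * (D + 2) ^ 2 + (D + 2) with hK₂
  set K₃ : ℝ := (4 * D + 4 + τ * Carpool.hashCost D + 1) + K₁ with hK₃
  have hK₁0 : 0 < K₁ := by positivity
  have hK₂0 : 0 < K₂ := by positivity
  have hK₃0 : 0 < K₃ := by positivity
  refine ⟨b, (K₁ + K₂ + K₃) * Carpool.tableFactor f, by positivity, ?_⟩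
  intro disc cost E hD hcost n k hn hk R hR
  have hn' : (0 : ℝ) < n := by exact_mod_cast hn
  set prm := Carpool.params c s scale ((P / 2) ^ 2) (1 / 2) f b k n with hprm
  have hnormq : ∀ r, ‖Carpool.scaledPrep disc cost E prm r‖ ^ 2 ≤ (1 - c) / 4 := fun r =>
    (Carpool.sq_norm_scaledPrep_le (hD.trans (Nat.le_succ D)) hcost).trans
      (Carpool.sq_ridesScale_mul_le hc0 hc1)
  have hlogn : 0 ≤ Real.log n := Real.log_natCast_nonneg n
  have hlogk : 0 ≤ Real.log ((k : ℝ) + 1) :=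
    Real.log_nonneg (by linarith [Nat.cast_nonneg (α := ℝ) k])
  have hL : 0 < prm.L :=
    Nat.ceil_pos.2 (mul_pos (Real.rpow_pos_of_pos hn' _) (Carpool.log_div_pos hf0 hf1 hk))
  have hLle : (prm.L : ℝ) ≤
      Carpool.tableFactor f * ((n : ℝ) ^ (1 / 2 : ℝ) * Real.log (k + 1)) :=
    Carpool.ceil_le_tableFactor_mul hn hk hf0 hf1
  have ht : (prm.t : ℝ) ≤ τ * Real.log n := by
    rw [hτ, one_div_mul_eq_div]
    exact Nat.floor_le (by positivity)
  have hpow : (n : ℝ) ^ (1 + 1 / 2 : ℝ) = n * (n : ℝ) ^ (1 / 2 : ℝ) := by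
    rw [Real.rpow_add hn', Real.rpow_one]
  have hu : 0 ≤ (k : ℝ) + Real.log n := by positivity
  have hΛ : 0 ≤ (n : ℝ) ^ (1 / 2 : ℝ) * Real.log (k + 1) := by positivity
  refine ⟨fun i => ?_, ?_, fun ω q _ => ?_, fun ω => ?_, fun ω => ?_⟩
  · exact abs_le_of_sq_le_sq' (by nlinarith [hnormq (R i)]) (by norm_num) |>.2
  · rintro q hq ⟨T, hT, hsim⟩
    have h := Carpool.real_failureEvent_le_of_params (prm := prm) (R := R) (b := b) (m := m)
      hn hk hc0 hc1 hs hscale0 hf0 hf1 (Nat.succ_pos D) (hD.trans (Nat.le_succ D)) hcost hR hq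
      (fun i => hnormq (R i)) rfl rfl (Nat.le_ceil _) hL rfl
      (by rw [lt_div_iff₀ (by positivity), mul_comm] at hm; exact hm) hb hT hsim
    rw [← ENNReal.ofReal_toReal (MeasureTheory.measure_ne_top _ _)]
    exact ENNReal.ofReal_le_ofReal h
  · have h := Carpool.runQuery_steps_le_mul (disc := disc) (cost := cost) (R := R) (q := q)
      (b := b) hD rfl hL hk hτ0.le hlogn ht ω
    refine h.trans ?_
    calc K₁ * (prm.L * (k + Real.log n))
        ≤ (K₁ + K₂ + K₃) * (Carpool.tableFactor f *
          ((n : ℝ) ^ (1 / 2 : ℝ) * Real.log (k + 1)) * (k + Real.log n)) := by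
          gcongr; linarith
      _ = _ := by ring
  · have h := Carpool.indexWords_le_mul (disc := disc) (cost := cost) (R := R)
      hD hL hτ0.le (Carpool.log_natCast_le_self hn) ht ω
    refine h.trans ?_
    calc K₂ * (prm.L * n)
        ≤ (K₁ + K₂ + K₃) * (Carpool.tableFactor f *
          ((n : ℝ) ^ (1 / 2 : ℝ) * Real.log (k + 1)) * n) := by
          gcongr; linarith
      _ = _ := by rw [hpow]; ring
  · have h := Carpool.totalSteps_le_mul (disc := disc) (cost := cost) (R := R)
      (b := b) hD rfl hL hk hτ0.le hlogn ht ω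
    refine h.trans ?_
    calc K₃ * (n * (prm.L * (k + Real.log n)))
        ≤ (K₁ + K₂ + K₃) * (n * (Carpool.tableFactor f *
          ((n : ℝ) ^ (1 / 2 : ℝ) * Real.log (k + 1)) * (k + Real.log n))) := by
          gcongr; linarith
      _ = _ := by rw [hpow]; ring
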